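/- **Setting.** Let $d,\alpha>0$ and $c_*=2\sqrt{d\alpha}$. A *critical front* is a $C^2$ function $q_*:\mathbb R\to\mathbb R$ with $d q_*''+c_*q_*'+\alpha q_*(1-q_*^2)=0$, $q_*(-\infty)=1$, $q_*(+\infty)=0$. For $\beta,\mu,\gamma\in\mathbb R$ put $$\mathcal A=\begin{pmatrix}\mathcal A^{\rm kpp}&\beta\\0&\mathcal A^{\rm sh}\end{pmatrix},\quad \mathcal A^{\rm kpp}=d\partial_{xx}+c_*\partial_x+\alpha(1-3q_*^2),\quad \mathcal A^{\rm sh}=-(1+\partial_{xx})^2+c_*\partial_x+\mu-\gamma(1-q_*).$$ For $\theta<0$ let $\omega_*=\omega_{\rm kpp}\,\omega_{\rm sh}$, where $\omega_{\rm kpp},\omega_{\rm sh}$ are smooth positive functions on $\mathbb R$ with $\omega_{\rm kpp}(x)=1$, $\omega_{\rm sh}(x)=e^{\theta x}$ for $x\le-1$ and $\omega_{\rm kpp}(x)=e^{-\frac{c_*}{2d}x}$, $\omega_{\rm sh}(x)=1$ for $x\ge1$. Let $\mathcal L^{i}=\omega_*^{-1}\mathcal A^{i}\omega_*$ for $i\in\{{\rm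 kpp},{\rm sh}\}$ and $$\mathcal L=\omega_*^{-1}\mathcal A\,\omega_*=\begin{pmatrix}\mathcal L^{\rm kpp}&\beta\\0&\mathcal L^{\rm sh}\end{pmatrix}\quad\text{on } L^2(\mathbb R,\mathbb C)^2\text{ with domain }H^2\times H^4.$$ Let $\mathcal L^{i,\pm}$ be the constant-coefficient operator on $L^2(\mathbb R,\mathbb C)$, with domain $H^2$ for $i={\rm kpp}$ and $H^4$ for $i={\rm sh}$, whose coefficients are the limits at $\pm\infty$ of the coefficients of $\mathcal L^{i}$. For a closed operator $T$, $\sigma(T)$ is the set of $\lambda\in\mathbb C$ for which $\lambda-T$ has no bounded inverse, and $\sigma_{\rm ess}(T)$ is the set of $\lambda\in\sigma(T)$ for which the Fredholm index $\dim\ker(\lambda-T)-\operatorname{codim}\operatorname{ran}(\lambda-T)$ is either not defined (kernel or cokernel of infinite dimension) or nonzero. **Proposition.** Fix $\alpha,d>0$. For every sufficiently small $\mu_0>0$ and every $0<\mu<\mu_0$ there is $\theta=\theta(\mu_0,\mu)<0$, with $\theta(\mu_0,\mu)\to0$ as $\mu_0\to0$ uniformly in $\mu\in(0,\mu_0)$,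 such that the following holds. For every $$\gamma>\gamma_{\rm rem}:=8\Big(\frac{\alpha}{d}\Big)^2+4\frac{\alpha}{d}-2\alpha+\mu_0$$ there is $\eta>0$, depending only on $\mu_0,d,\alpha,\gamma$, such that for all $0<\mu<\mu_0$, all $\beta\in\mathbb R$, every critical front $q_*$ and every weight $\omega_*$ as above with exponent $\theta=\theta(\mu_0,\mu)$, the coefficients of $\mathcal L^{\rm kpp}$ and $\mathcal L^{\rm sh}$ have limits at $\pm\infty$, and $$\sigma(\mathcal L^{{\rm kpp},+})=\{-\xi^2:\xi\in\mathbb R\},\qquad \sigma(\mathcal L^{{\rm kpp},-})\cup\sigma(\mathcal L^{{\rm sh},+})\cup\sigma(\mathcal L^{{\rm sh},-})\subset\{\lambda\in\mathbb C:\operatorname{Re}\lambda\le-3\eta\},$$ $$\sigma_{\rm ess}(\mathcal L)\subset\{\lambda\in\mathbb C:\operatorname{Re}\lambda\le-3\eta\}\cup\{-\xi^2:\xi\in\mathbb R\}.$$ In particular $\sigma_{\rm ess}(\mathcal L)\subset\{\operatorname{Re}\lambda\le-\eta\}\cup\{-\xi^2:\xi\in\mathbb R\}$. -/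

import Mathlib

open MeasureTheory Filter Topology
open scoped SchwartzMap LineDeriv ContDiff

noncomputable section

namespace FrontSpectrum

/-! ### Spectrum and essential spectrum of an unbounded operator -/

section Spectrum

variable {E : Type*} [NormedAddCommGroup E] [NormedSpace ℂ E]

/-- The linear map `z - T`, from the domain of `T` to the ambient space. -/
def shifted (T : E →ₗ.[ℂ] E) (z : ℂ) : T.domain →ₗ[ℂ] E :=
  z • T.domain.subtype - T.toFun

/-- `z - T` is boundedly invertible: it is a bijection from the domain of `T` onto `E` whose inverse
is (the corestriction of) a bounded operator `R` on `E`. -/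
def BoundedlyInvertible (T : E →ₗ.[ℂ] E) (z : ℂ) : Prop :=
  ∃ R : E →L[ℂ] E,
    (∀ f : E, ∃ h : R f ∈ T.domain, shifted T z ⟨R f, h⟩ = f) ∧
    ∀ u : T.domain, R (shifted T z u) = u

/-- The spectrum of `T`. -/
def spec (T : E →ₗ.[ℂ] E) : Set ℂ :=
  {z | ¬ BoundedlyInvertible T z}

/-- `z - T` has finite-dimensional kernel and range of finite codimension, i.e. its Fredholm index
is defined and finite. -/
def IsFredholmAt (T : E →ₗ.[ℂ] E) (z : ℂ) : Prop :=
  FiniteDimensional ℂ (LinearMap.ker (shifted T z)) ∧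
    FiniteDimensional ℂ (E ⧸ LinearMap.range (shifted T z))

/-- The Fredholm index `dim ker (z - T) - codim range (z - T)`; meaningful under `IsFredholmAt`. -/
def fredholmIndex (T : E →ₗ.[ℂ] E) (z : ℂ) : ℤ :=
  (Module.finrank ℂ (LinearMap.ker (shifted T z)) : ℤ) -
    (Module.finrank ℂ (E ⧸ LinearMap.range (shifted T z)) : ℤ)

/-- The essential spectrum: the points of the spectrum at which the Fredholm index is either
undefined or nonzero. -/
def essSpec (T : E →ₗ.[ℂ] E) : Set ℂ :=
  {z | z ∈ spec T ∧ ¬ (IsFredholmAt T z ∧ fredholmIndex T z = 0)}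

/-- The upper triangular operator matrix `(T₁, β; 0, T₂)` on `E × E`, with domain
`dom T₁ × dom T₂`. -/
def triangular (T₁ : E →ₗ.[ℂ] E) (β : ℂ) (T₂ : E →ₗ.[ℂ] E) : (E × E) →ₗ.[ℂ] (E × E) where
  domain := T₁.domain.prod T₂.domain
  toFun :=
    { toFun := fun u => (T₁ ⟨u.1.1, u.2.1⟩ + β • u.1.2, T₂ ⟨u.1.2, u.2.2⟩)
      map_add' := by
        intro u v
        have h1 := T₁.map_add ⟨u.1.1, u.2.1⟩ ⟨v.1.1, v.2.1⟩
        have h2 := T₂.map_add ⟨u.1.2, u.2.2⟩ ⟨v.1.2, v.2.2⟩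
        refine Prod.ext ?_ h2
        change T₁ (⟨u.1.1, u.2.1⟩ + ⟨v.1.1, v.2.1⟩) + β • (u.1.2 + v.1.2) = _
        rw [h1, smul_add]
        exact add_add_add_comm _ _ _ _
      map_smul' := by
        intro c u
        have h1 := T₁.map_smul c ⟨u.1.1, u.2.1⟩
        have h2 := T₂.map_smul c ⟨u.1.2, u.2.2⟩
        refine Prod.ext ?_ h2
        change T₁ (c • ⟨u.1.1, u.2.1⟩) + β • (c • u.1.2) = _
        rw [h1, smul_comm β c, ← smul_add]
        rfl }

end Spectrum

/-! ### Differential operators on `L²(ℝ, ℂ)` -/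

/-- The space `L²(ℝ, ℂ)`. -/
abbrev L2 : Type := Lp ℂ 2 (volume : Measure ℝ)

/-- The `k`-th distributional derivative of an `L²` function. -/
def distDeriv (k : ℕ) (u : L2) : 𝓢'(ℝ, ℂ) :=
  ∂^{fun _ : Fin k => (1 : ℝ)} (u : 𝓢'(ℝ, ℂ))

theorem distDeriv_add (k : ℕ) (u v : L2) :
    distDeriv k (u + v) = distDeriv k u + distDeriv k v := by
  have h : ((u + v : L2) : 𝓢'(ℝ, ℂ)) = (u : 𝓢'(ℝ, ℂ)) + (v : 𝓢'(ℝ, ℂ)) :=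
    map_add (Lp.toTemperedDistributionCLM ℂ volume 2) u v
  rw [distDeriv, h, LineDeriv.iteratedLineDerivOp_add]
  rfl

theorem distDeriv_smul (k : ℕ) (c : ℂ) (u : L2) : distDeriv k (c • u) = c • distDeriv k u := by
  have h : ((c • u : L2) : 𝓢'(ℝ, ℂ)) = c • (u : 𝓢'(ℝ, ℂ)) :=
    map_smul (Lp.toTemperedDistributionCLM ℂ volume 2) c u
  rw [distDeriv, h, LineDeriv.iteratedLineDerivOp_smul]
  rfl

theorem coe_injective {f g : L2} (h : (f : 𝓢'(ℝ, ℂ)) = (g : 𝓢'(ℝ, ℂ))) : f = g := by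
  have hk := Lp.ker_toTemperedDistributionCLM_eq_bot (F := ℂ) (μ := (volume : Measure ℝ)) (p := 2)
  exact LinearMap.ker_eq_bot.mp hk h

/-- The Sobolev space `Hⁿ(ℝ, ℂ)`, as a subspace of `L²(ℝ, ℂ)`. -/
def sobolev (n : ℕ) : Submodule ℂ L2 where
  carrier := {u | TemperedDistribution.MemSobolev (n : ℝ) 2 (u : 𝓢'(ℝ, ℂ))}
  add_mem' := by
    intro u v hu hv
    have h : ((u + v : L2) : 𝓢'(ℝ, ℂ)) = (u : 𝓢'(ℝ, ℂ)) + (v : 𝓢'(ℝ, ℂ)) :=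
      map_add (Lp.toTemperedDistributionCLM ℂ volume 2) u v
    simp only [Set.mem_ofPred_eq, h]
    exact hu.add hv
  zero_mem' := by
    have h : ((0 : L2) : 𝓢'(ℝ, ℂ)) = 0 := map_zero (Lp.toTemperedDistributionCLM ℂ volume 2)
    simp only [Set.mem_ofPred_eq, h]
    exact TemperedDistribution.memSobolev_fun_zero ℝ ℂ _ _
  smul_mem' := by
    intro c u hu
    have h : ((c • u : L2) : 𝓢'(ℝ, ℂ)) = c • (u : 𝓢'(ℝ, ℂ)) :=
      map_smul (Lp.toTemperedDistributionCLM ℂ volume 2) c u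
    simp only [Set.mem_ofPred_eq, h]
    exact hu.smul c

theorem memSobolev_distDeriv {n : ℕ} {u : L2} (hu : u ∈ sobolev n) (k : ℕ) :
    TemperedDistribution.MemSobolev ((n : ℝ) - k) 2 (distDeriv k u) := by
  induction k with
  | zero =>
    have h : TemperedDistribution.MemSobolev (n : ℝ) 2 (u : 𝓢'(ℝ, ℂ)) := hu
    simpa [distDeriv] using h
  | succ k ih =>
    have h := ih.lineDerivOp (m := (1 : ℝ))
    have e : (n : ℝ) - (k + 1 : ℕ) = (n : ℝ) - k - 1 := by push_cast; ring
    rw [e]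
    have e2 : distDeriv (k + 1) u = ∂_{(1 : ℝ)} (distDeriv k u) := by
      rw [distDeriv, LineDeriv.iteratedLineDerivOp_succ_left]
      rfl
    rw [e2]
    exact h

/-- The derivatives up to order `n` of a function in `Hⁿ` are `L²` functions. -/
theorem exists_weakDeriv {n : ℕ} {u : L2} (hu : u ∈ sobolev n) {k : ℕ} (hk : k ≤ n) :
    ∃ g : L2, (g : 𝓢'(ℝ, ℂ)) = distDeriv k u := by
  have h := (memSobolev_distDeriv hu k).mono (s' := 0) (by
    have : (k : ℝ) ≤ n := by exact_mod_cast hk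
    linarith)
  obtain ⟨g, hg⟩ := TemperedDistribution.memSobolev_zero_iff.mp h
  exact ⟨g, hg.symm⟩

open Classical in
/-- The `k`-th weak derivative of `u`, as an `L²` function. It exists for `u ∈ Hⁿ` and `k ≤ n`
(`exists_weakDeriv`), and only this case is used; it is `0` if the distributional derivative is not
an `L²` function. -/
def weakDeriv (k : ℕ) (u : L2) : L2 :=
  if h : ∃ g : L2, (g : 𝓢'(ℝ, ℂ)) = distDeriv k u then h.choose else 0

theorem weakDeriv_spec {n : ℕ} {u : L2} (hu : u ∈ sobolev n) {k : ℕ} (hk : k ≤ n) :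
    (weakDeriv k u : 𝓢'(ℝ, ℂ)) = distDeriv k u := by
  have h := exists_weakDeriv hu hk
  rw [weakDeriv, dif_pos h]
  exact h.choose_spec

theorem weakDeriv_add {n : ℕ} {u v : L2} (hu : u ∈ sobolev n) (hv : v ∈ sobolev n) {k : ℕ}
    (hk : k ≤ n) : weakDeriv k (u + v) = weakDeriv k u + weakDeriv k v := by
  apply coe_injective
  have h : ((weakDeriv k u + weakDeriv k v : L2) : 𝓢'(ℝ, ℂ)) =
      (weakDeriv k u : 𝓢'(ℝ, ℂ)) + (weakDeriv k v : 𝓢'(ℝ, ℂ)) :=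
    map_add (Lp.toTemperedDistributionCLM ℂ volume 2) _ _
  rw [h, weakDeriv_spec ((sobolev n).add_mem hu hv) hk, weakDeriv_spec hu hk,
    weakDeriv_spec hv hk, distDeriv_add]

theorem weakDeriv_smul {n : ℕ} (c : ℂ) {u : L2} (hu : u ∈ sobolev n) {k : ℕ}
    (hk : k ≤ n) : weakDeriv k (c • u) = c • weakDeriv k u := by
  apply coe_injective
  have h : ((c • weakDeriv k u : L2) : 𝓢'(ℝ, ℂ)) = c • (weakDeriv k u : 𝓢'(ℝ, ℂ)) :=
    map_smul (Lp.toTemperedDistributionCLM ℂ volume 2) _ _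
  rw [h, weakDeriv_spec ((sobolev n).smul_mem c hu) hk, weakDeriv_spec hu hk, distDeriv_smul]

/-- The function `∑_{k ≤ n} a_k ∂ₓᵏ u`. -/
def diffExpr (n : ℕ) (a : ℕ → ℝ → ℝ) (u : L2) : ℝ → ℂ :=
  fun x => ∑ k ∈ Finset.range (n + 1), (a k x : ℂ) * weakDeriv k u x

theorem diffExpr_add (n : ℕ) (a : ℕ → ℝ → ℝ) {u v : L2} (hu : u ∈ sobolev n)
    (hv : v ∈ sobolev n) :
    diffExpr n a (u + v) =ᵐ[volume] diffExpr n a u + diffExpr n a v := by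
  have h : ∀ᵐ x ∂(volume : Measure ℝ), ∀ k ∈ Finset.range (n + 1),
      weakDeriv k (u + v) x = weakDeriv k u x + weakDeriv k v x := by
    rw [Finset.eventually_all]
    intro k hk
    rw [weakDeriv_add hu hv (Finset.mem_range_succ_iff.mp hk)]
    exact Lp.coeFn_add _ _
  filter_upwards [h] with x hx
  simp only [diffExpr, Pi.add_apply, ← Finset.sum_add_distrib]
  exact Finset.sum_congr rfl fun k hk => by rw [hx k hk, mul_add]

theorem diffExpr_smul (n : ℕ) (a : ℕ → ℝ → ℝ) (c : ℂ) {u : L2} (hu : u ∈ sobolev n) :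
    diffExpr n a (c • u) =ᵐ[volume] c • diffExpr n a u := by
  have h : ∀ᵐ x ∂(volume : Measure ℝ), ∀ k ∈ Finset.range (n + 1),
      weakDeriv k (c • u) x = c • weakDeriv k u x := by
    rw [Finset.eventually_all]
    intro k hk
    rw [weakDeriv_smul c hu (Finset.mem_range_succ_iff.mp hk)]
    exact Lp.coeFn_smul _ _
  filter_upwards [h] with x hx
  simp only [diffExpr, Pi.smul_apply, Finset.smul_sum]
  exact Finset.sum_congr rfl fun k hk => by
    rw [hx k hk, smul_eq_mul, smul_eq_mul, mul_left_comm]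

/-- The differential operator `∑_{k ≤ n} a_k(x) ∂ₓᵏ` in `L²(ℝ, ℂ)`, defined on those `u ∈ Hⁿ` for
which `∑_{k ≤ n} a_k ∂ₓᵏ u` is square integrable. For bounded measurable coefficients, as in all
the uses below, the domain is the whole of `Hⁿ`, see `diffOp_domain`. -/
def diffOp (n : ℕ) (a : ℕ → ℝ → ℝ) : L2 →ₗ.[ℂ] L2 where
  domain :=
    { carrier := {u | u ∈ sobolev n ∧ MemLp (diffExpr n a u) 2 volume}
      add_mem' := fun hu hv => ⟨(sobolev n).add_mem hu.1 hv.1,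
        (hu.2.add hv.2).ae_eq (diffExpr_add n a hu.1 hv.1).symm⟩
      zero_mem' := by
        refine ⟨(sobolev n).zero_mem, ?_⟩
        have h := diffExpr_smul n a 0 (sobolev n).zero_mem
        rw [zero_smul, zero_smul] at h
        exact MemLp.zero.ae_eq h.symm
      smul_mem' := fun c _ hu => ⟨(sobolev n).smul_mem c hu.1,
        (hu.2.const_smul c).ae_eq (diffExpr_smul n a c hu.1).symm⟩ }
  toFun :=
    { toFun := fun u => u.2.2.toLp (diffExpr n a u)
      map_add' := fun u v => by
        rw [← MemLp.toLp_add]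
        exact (MemLp.toLp_eq_toLp_iff _ _).mpr (diffExpr_add n a u.2.1 v.2.1)
      map_smul' := fun c u => by
        rw [RingHom.id_apply, ← MemLp.toLp_const_smul]
        exact (MemLp.toLp_eq_toLp_iff _ _).mpr (diffExpr_smul n a c u.2.1) }

theorem diffOp_domain (n : ℕ) (a : ℕ → ℝ → ℝ) (hm : ∀ k ≤ n, Measurable (a k))
    (hb : ∀ k ≤ n, ∃ C, ∀ x, |a k x| ≤ C) : (diffOp n a).domain = sobolev n := by
  refine le_antisymm (fun u hu => hu.1) fun u hu => ⟨hu, ?_⟩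
  refine memLp_finsetSum _ fun k hk => ?_
  have hk' := Finset.mem_range_succ_iff.mp hk
  obtain ⟨C, hC⟩ := hb k hk'
  refine (Lp.memLp (weakDeriv k u)).of_le_mul (c := C) ?_ ?_
  · exact ((Complex.measurable_ofReal.comp (hm k hk')).aestronglyMeasurable).mul
      (Lp.aestronglyMeasurable _)
  · refine Eventually.of_forall fun x => ?_
    rw [norm_mul, Complex.norm_real, Real.norm_eq_abs]
    gcongr
    exact hC x

/-- The coefficients of the conjugated operator `w⁻¹ (∑_{j ≤ n} a_j ∂ₓʲ) w`, as given by the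
Leibniz rule, see `conjCoeff_apply`. -/
def conjCoeff (n : ℕ) (w : ℝ → ℝ) (a : ℕ → ℝ → ℝ) : ℕ → ℝ → ℝ :=
  fun k x => ∑ j ∈ Finset.Icc k n,
    (j.choose k : ℝ) * a j x * (iteratedDeriv (j - k) w x / w x)

theorem conjCoeff_apply (n : ℕ) (w : ℝ → ℝ) (a : ℕ → ℝ → ℝ) (u : ℝ → ℂ)
    (hw : ContDiff ℝ ∞ w) (hu : ContDiff ℝ ∞ u) (x : ℝ) :
    ∑ k ∈ Finset.range (n + 1), (conjCoeff n w a k x : ℂ) * iteratedDeriv k u x =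
      (w x : ℂ)⁻¹ * ∑ j ∈ Finset.range (n + 1),
        (a j x : ℂ) * iteratedDeriv j (fun y => w y • u y) x := by
  have key : ∀ j, iteratedDeriv j (fun y => w y • u y) x =
      ∑ k ∈ Finset.range (j + 1),
        (j.choose k : ℂ) * ((iteratedDeriv (j - k) w x : ℝ) : ℂ) * iteratedDeriv k u x := by
    intro j
    have h1 : ContDiffAt ℝ j w x := (hw.of_le (by exact_mod_cast le_top)).contDiffAt
    have h2 : ContDiffAt ℝ j u x := (hu.of_le (by exact_mod_cast le_top)).contDiffAt
    have h := iteratedDerivWithin_smul (Set.mem_univ x) uniqueDiffOn_univ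
      h1.contDiffWithinAt h2.contDiffWithinAt
    simp only [iteratedDerivWithin_univ] at h
    change iteratedDeriv j (w • u) x = _
    rw [h, ← Finset.sum_range_reflect]
    refine Finset.sum_congr rfl fun k hk => ?_
    have hk' : k ≤ j := Finset.mem_range_succ_iff.mp hk
    rw [show j + 1 - 1 - k = j - k by omega, Nat.choose_symm hk', Nat.sub_sub_self hk']
    simp [mul_assoc]
  simp only [key, conjCoeff, Complex.ofReal_sum, Finset.sum_mul, Finset.mul_sum]
  rw [Finset.sum_sigma', Finset.sum_sigma']
  refine Finset.sum_bij' (fun p _ => ⟨p.2, p.1⟩) (fun p _ => ⟨p.2, p.1⟩) ?_ ?_ ?_ ?_ ?_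
  · intro p hp
    simp only [Finset.mem_sigma, Finset.mem_range, Finset.mem_Icc] at hp ⊢
    omega
  · intro p hp
    simp only [Finset.mem_sigma, Finset.mem_range, Finset.mem_Icc] at hp ⊢
    omega
  · intro p hp; rfl
  · intro p hp; rfl
  · intro p hp
    push_cast
    ring

/-- The coefficients of a differential operator have limits at `±∞`. -/
def HasAsymptotics (n : ℕ) (a : ℕ → ℝ → ℝ) : Prop :=
  ∀ k ≤ n, (∃ l, Tendsto (a k) atTop (𝓝 l)) ∧ ∃ l, Tendsto (a k) atBot (𝓝 l)

/-- The constant coefficients of the asymptotic operator at `+∞` (`l = atTop`) or `-∞`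
(`l = atBot`). -/
def asymptotic (l : Filter ℝ) (a : ℕ → ℝ → ℝ) : ℕ → ℝ → ℝ :=
  fun k _ => limUnder l (a k)

/-! ### The linearization at the critical front -/

/-- The critical speed `c_* = 2 √(d α)`. -/
def critSpeed (d α : ℝ) : ℝ := 2 * √(d * α)

/-- `q` is the profile of a front of `∂ₜ u = d ∂ₓₓ u + α u (1 - u²)` that travels at the critical
speed and connects `1` at `-∞` to `0` at `+∞`. -/
structure IsCriticalFront (d α : ℝ) (q : ℝ → ℝ) : Prop where
  contDiff : ContDiff ℝ 2 q
  ode : ∀ x, d * iteratedDeriv 2 q x + critSpeed d α * deriv q x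
    + α * q x * (1 - q x ^ 2) = 0
  tendsto_atBot : Tendsto q atBot (𝓝 1)
  tendsto_atTop : Tendsto q atTop (𝓝 0)

/-- Coefficients of `A^kpp = d ∂ₓₓ + c_* ∂ₓ + α (1 - 3 q²)`. -/
def kppCoeff (d α : ℝ) (q : ℝ → ℝ) : ℕ → ℝ → ℝ
  | 0 => fun x => α * (1 - 3 * q x ^ 2)
  | 1 => fun _ => critSpeed d α
  | 2 => fun _ => d
  | _ => fun _ => 0

/-- Coefficients of `A^sh = -(1 + ∂ₓₓ)² + c_* ∂ₓ + μ - γ (1 - q)`. -/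
def shCoeff (d α μ γ : ℝ) (q : ℝ → ℝ) : ℕ → ℝ → ℝ
  | 0 => fun x => -1 + μ - γ * (1 - q x)
  | 1 => fun _ => critSpeed d α
  | 2 => fun _ => -2
  | 4 => fun _ => -1
  | _ => fun _ => 0

/-- A smooth positive weight equal to `1` on `(-∞, -1]` and to `exp (- c_* x / (2 d))` on
`[1, ∞)`. -/
structure IsKppWeight (d α : ℝ) (w : ℝ → ℝ) : Prop where
  contDiff : ContDiff ℝ ∞ w
  pos : ∀ x, 0 < w x
  eq_left : ∀ x ≤ -1, w x = 1
  eq_right : ∀ x, 1 ≤ x → w x = Real.exp (-(critSpeed d α / (2 * d)) * x)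

/-- A smooth positive weight equal to `exp (θ x)` on `(-∞, -1]` and to `1` on `[1, ∞)`. -/
structure IsShWeight (θ : ℝ) (w : ℝ → ℝ) : Prop where
  contDiff : ContDiff ℝ ∞ w
  pos : ∀ x, 0 < w x
  eq_left : ∀ x ≤ -1, w x = Real.exp (θ * x)
  eq_right : ∀ x, 1 ≤ x → w x = 1

/-- Coefficients of `L^kpp = w⁻¹ A^kpp w`. -/
def kppConj (d α : ℝ) (q w : ℝ → ℝ) : ℕ → ℝ → ℝ :=
  conjCoeff 2 w (kppCoeff d α q)

/-- Coefficients of `L^sh = w⁻¹ A^sh w`. -/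
def shConj (d α μ γ : ℝ) (q w : ℝ → ℝ) : ℕ → ℝ → ℝ :=
  conjCoeff 4 w (shCoeff d α μ γ q)

/-- The weighted linearization `L = w⁻¹ A w = (L^kpp, β; 0, L^sh)` in `L²(ℝ, ℂ)²`, with domain
`H² × H⁴`. -/
def weightedOp (d α β μ γ : ℝ) (q w : ℝ → ℝ) : (L2 × L2) →ₗ.[ℂ] (L2 × L2) :=
  triangular (diffOp 2 (kppConj d α q w)) (β : ℂ) (diffOp 4 (shConj d α μ γ q w))

/-- The threshold `γ_rem`. -/
def gammaRem (d α μ₀ : ℝ) : ℝ :=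
  8 * (α / d) ^ 2 + 4 * (α / d) - 2 * α + μ₀

/-- The half line `{-ξ² : ξ ∈ ℝ}` in the complex plane. -/
def negSquares : Set ℂ := {z | ∃ ξ : ℝ, z = -(ξ : ℂ) ^ 2}

/-- The closed half plane `{Re z ≤ r}`. -/
def leftHalfPlane (r : ℝ) : Set ℂ := {z | z.re ≤ r}

end FrontSpectrum

end

open FrontSpectrum

/-! It suffices to show that `z - L` has index zero for every `z` outside the claimed set; whether
`z` lies in the spectrum is then irrelevant (`notMem_essSpec`). Index zero is used in the algebraic
form "isomorphism plus finite rank". In this form it passes to triangular matrices for any coupling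
`β`, so the two diagonal entries can be treated separately.

A scalar operator `z - ∑ a_k ∂ₓᵏ` becomes bounded on `L²` after composition with the isomorphism `(1
+ ∂ₓ/(2π))⁻ⁿ : L² → Hⁿ` (`shifted_diffOp_domainEquiv`). Calculations are then made modulo norm
limits of finite-rank operators. The basic fact is that `φ(x) m(D)` is such a limit if `φ` and `m`
vanish at infinity (`mulOp_mul_fmul_mem`). It has three consequences. The coefficients may be
replaced by `l₋ + χ (l₊ - l₋)` with a cutoff `χ`, because the top coefficient is constant and the
lower-order symbols decay. The cutoff commutes with the relevant multipliers. The map `m ↦ (1 - χ) +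
χ m(D)` is multiplicative (`gluing_mul_sub_mem`).

The operator with interpolated coefficients is the gluing of the quotient (symbol at `+∞`)/(symbol
at `-∞`), times the invertible multiplier that belongs to `-∞`. If a quotient takes values in the
slit plane and tends to `1`, the segment to `1` avoids zero, and dividing it into small steps writes
the gluing as a product of Neumann-series units (`almostUnit_gluing`). No winding number is needed.
One factorization through a third symbol covers both operators (`almostUnit_totalOp`).

What remains is to locate the symbols. Conjugation by `exp (ρ x)` replaces `∂ₓ` by `∂ₓ + ρ`. At `+∞`
the critical weight turns the KPP symbol into `-d (2πξ)²`. The real part of the Swift-Hohenberg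
symbol is maximized by completing a square (`re_polySymbol_sh_le`), which produces `gammaRem`. At
`-∞` a small negative exponent makes the transport term `c_* θ` outweigh `μ`. -/

noncomputable section

namespace FrontSpectrum

/-! ### Linear maps of index zero -/

section IndexZero

variable {V W V' W' : Type*} [AddCommGroup V] [Module ℂ V] [AddCommGroup W] [Module ℂ W]
  [AddCommGroup V'] [Module ℂ V'] [AddCommGroup W'] [Module ℂ W']

/-- `T` is a finite-rank perturbation of a linear isomorphism. -/
def IndexZero (T : V →ₗ[ℂ] W) : Prop :=
  ∃ e : V ≃ₗ[ℂ] W, FiniteDimensional ℂ (LinearMap.range (T - e.toLinearMap))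

theorem IndexZero.comp_equiv {T : V →ₗ[ℂ] W} (hT : IndexZero T) (e : V' ≃ₗ[ℂ] V) :
    IndexZero (T ∘ₗ e.toLinearMap) := by
  obtain ⟨e', he'⟩ := hT
  refine ⟨e.trans e', ?_⟩
  have h : T ∘ₗ e.toLinearMap - (e.trans e').toLinearMap = (T - e'.toLinearMap) ∘ₗ e.toLinearMap := by
    ext x; simp
  rw [h]
  exact Submodule.finiteDimensional_of_le (LinearMap.range_comp_le_range _ _)

/-- The kernel and the cokernel of a finite-rank perturbation of the identity have the same finite
dimension. -/
theorem finrank_ker_eq_finrank_coker_of_sub_one (S : W →ₗ[ℂ] W)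
    (hS : FiniteDimensional ℂ (LinearMap.range (S - 1))) :
    FiniteDimensional ℂ (LinearMap.ker S) ∧ FiniteDimensional ℂ (W ⧸ LinearMap.range S) ∧
      Module.finrank ℂ (LinearMap.ker S) = Module.finrank ℂ (W ⧸ LinearMap.range S) := by
  set U := LinearMap.range (S - 1) with hU
  -- `S` is the identity modulo `U`. Hence it preserves `U`, its kernel lies in `U`, and its
  -- cokernel is that of its restriction to `U`, where rank-nullity applies.
  have hSU : ∀ x, S x - x ∈ U := fun x => ⟨x, by simp⟩
  have hmap : ∀ u ∈ U, S u ∈ U := fun u hu => by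
    have := U.add_mem (hSU u) hu
    simpa using this
  have hback : ∀ x, S x ∈ U → x ∈ U := fun x hx => by
    have := U.sub_mem hx (hSU x)
    simpa using this
  let SU : U →ₗ[ℂ] U := S.restrict hmap
  let ek : LinearMap.ker SU ≃ₗ[ℂ] LinearMap.ker S :=
    LinearEquiv.ofBijective
      ((U.subtype ∘ₗ (LinearMap.ker SU).subtype).codRestrict (LinearMap.ker S) (fun u => by
        have h : SU u.1 = 0 := u.2
        exact congrArg Subtype.val h))
      ⟨fun u v h => by
          have h' := congrArg Subtype.val h
          exact Subtype.ext (Subtype.ext h'), fun x => by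
        have hx : S x.1 = 0 := x.2
        exact ⟨⟨⟨x.1, hback _ (by rw [hx]; exact U.zero_mem)⟩, Subtype.ext hx⟩, rfl⟩⟩
  let p : U →ₗ[ℂ] W ⧸ LinearMap.range S := (LinearMap.range S).mkQ ∘ₗ U.subtype
  have hp : Function.Surjective p := by
    intro y
    obtain ⟨w, rfl⟩ := Submodule.mkQ_surjective _ y
    refine ⟨-⟨S w - w, hSU w⟩, ?_⟩
    change (LinearMap.range S).mkQ (-(S w - w)) = _
    rw [← sub_eq_zero, ← map_sub, Submodule.mkQ_apply, Submodule.Quotient.mk_eq_zero]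
    exact ⟨-w, by simp⟩
  have hker : LinearMap.ker p = LinearMap.range SU := by
    ext u
    rw [LinearMap.mem_ker]
    change (LinearMap.range S).mkQ u.1 = 0 ↔ _
    rw [Submodule.mkQ_apply, Submodule.Quotient.mk_eq_zero]
    constructor
    · rintro ⟨x, hx⟩
      exact ⟨⟨x, hback x (hx ▸ u.2)⟩, Subtype.ext hx⟩
    · rintro ⟨x, hx⟩
      exact ⟨x.1, congrArg Subtype.val hx⟩
  have hfin : FiniteDimensional ℂ (W ⧸ LinearMap.range S) := Module.Finite.of_surjective p hp
  refine ⟨ek.finiteDimensional, hfin, ?_⟩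
  have h1 := LinearMap.finrank_range_add_finrank_ker SU
  have h2 := LinearMap.finrank_range_add_finrank_ker p
  rw [hker, LinearMap.range_eq_top.mpr hp, finrank_top] at h2
  rw [← ek.finrank_eq]
  omega

/-- Composing with `e⁻¹` reduces this to a finite-rank perturbation of the identity. -/
theorem IndexZero.finrank_ker_eq {T : V →ₗ[ℂ] W} (hT : IndexZero T) :
    FiniteDimensional ℂ (LinearMap.ker T) ∧ FiniteDimensional ℂ (W ⧸ LinearMap.range T) ∧
      Module.finrank ℂ (LinearMap.ker T) = Module.finrank ℂ (W ⧸ LinearMap.range T) := by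
  obtain ⟨e, he⟩ := hT
  have hS : FiniteDimensional ℂ (LinearMap.range (T ∘ₗ e.symm.toLinearMap - 1)) := by
    have h : T ∘ₗ e.symm.toLinearMap - 1 = (T - e.toLinearMap) ∘ₗ e.symm.toLinearMap := by
      ext x; simp
    rw [h]
    exact Submodule.finiteDimensional_of_le (LinearMap.range_comp_le_range _ _)
  obtain ⟨h1, h2, h3⟩ := finrank_ker_eq_finrank_coker_of_sub_one _ hS
  have hr : LinearMap.range (T ∘ₗ e.symm.toLinearMap) = LinearMap.range T := by
    rw [LinearMap.range_comp, LinearEquiv.range, Submodule.map_top]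
  rw [hr] at h2 h3
  let ek : LinearMap.ker T ≃ₗ[ℂ] LinearMap.ker (T ∘ₗ e.symm.toLinearMap) :=
    e.submoduleMap (LinearMap.ker T) |>.trans (LinearEquiv.ofEq _ _ (by
      ext x
      simp only [Submodule.mem_map, LinearMap.mem_ker, LinearMap.comp_apply]
      constructor
      · rintro ⟨y, hy, rfl⟩
        simpa using hy
      · intro hx
        exact ⟨e.symm x, hx, by simp⟩))
  refine ⟨ek.symm.finiteDimensional, h2, ?_⟩
  rw [ek.finrank_eq, h3]

/-- An upper triangular matrix whose diagonal entries have index zero has index zero. -/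
theorem IndexZero.triangular {T₁ : V →ₗ[ℂ] W} {T₂ : V' →ₗ[ℂ] W'} (h₁ : IndexZero T₁)
    (h₂ : IndexZero T₂) (B : V' →ₗ[ℂ] W) :
    IndexZero ((T₁.coprod B).prod (T₂ ∘ₗ LinearMap.snd ℂ V V')) := by
  obtain ⟨e₁, he₁⟩ := h₁
  obtain ⟨e₂, he₂⟩ := h₂
  -- The comparison isomorphism carries the same off-diagonal entry `B`. The difference is then
  -- block diagonal, and nothing has to be assumed about `B`.
  let e : (V × V') ≃ₗ[ℂ] (W × W') :=
    { (e₁.toLinearMap.coprod B).prod (e₂.toLinearMap ∘ₗ LinearMap.snd ℂ V V') with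
      invFun := fun y => (e₁.symm (y.1 - B (e₂.symm y.2)), e₂.symm y.2)
      left_inv := fun x => by simp
      right_inv := fun y => by simp }
  refine ⟨e, ?_⟩
  have h : (T₁.coprod B).prod (T₂ ∘ₗ LinearMap.snd ℂ V V') - e.toLinearMap =
      (T₁ - e₁.toLinearMap).prodMap (T₂ - e₂.toLinearMap) := by
    refine LinearMap.ext fun x => Prod.ext ?_ rfl
    change T₁ x.1 + B x.2 - (e₁ x.1 + B x.2) = T₁ x.1 - e₁ x.1
    abel
  rw [h, LinearMap.range_prodMap]
  rw [← Submodule.fg_iff_finiteDimensional] at he₁ he₂ ⊢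
  exact he₁.prod he₂

end IndexZero

section Approximable

variable {E : Type*} [NormedAddCommGroup E] [NormedSpace ℂ E]

variable (E) in
/-- The bounded operators of finite rank. -/
def finiteRank : Submodule ℂ (E →L[ℂ] E) where
  carrier := {T | FiniteDimensional ℂ (LinearMap.range (T : E →ₗ[ℂ] E))}
  add_mem' := by
    intro S T (hS : FiniteDimensional ℂ _) (hT : FiniteDimensional ℂ _)
    exact Submodule.finiteDimensional_of_le (LinearMap.range_add_le (S : E →ₗ[ℂ] E) T)
  zero_mem' := by
    change FiniteDimensional ℂ (LinearMap.range (0 : E →ₗ[ℂ] E))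
    rw [LinearMap.range_zero]
    infer_instance
  smul_mem' := by
    intro c T (hT : FiniteDimensional ℂ _)
    refine Submodule.finiteDimensional_of_le (S₂ := LinearMap.range (T : E →ₗ[ℂ] E)) ?_
    rintro _ ⟨x, rfl⟩
    exact ⟨c • x, by simp⟩

theorem mul_mem_finiteRank_left (S : E →L[ℂ] E) {T : E →L[ℂ] E} (hT : T ∈ finiteRank E) :
    S * T ∈ finiteRank E := by
  have : FiniteDimensional ℂ (LinearMap.range (T : E →ₗ[ℂ] E)) := hT
  change FiniteDimensional ℂ (LinearMap.range ((S : E →ₗ[ℂ] E) ∘ₗ (T : E →ₗ[ℂ] E)))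
  rw [LinearMap.range_comp]
  infer_instance

theorem mul_mem_finiteRank_right (S : E →L[ℂ] E) {T : E →L[ℂ] E} (hT : T ∈ finiteRank E) :
    T * S ∈ finiteRank E := by
  have : FiniteDimensional ℂ (LinearMap.range (T : E →ₗ[ℂ] E)) := hT
  change FiniteDimensional ℂ (LinearMap.range ((T : E →ₗ[ℂ] E) ∘ₗ (S : E →ₗ[ℂ] E)))
  exact Submodule.finiteDimensional_of_le (LinearMap.range_comp_le_range _ _)

variable (E) in
/-- The operators that are norm limits of operators of finite rank. -/
def approximable : Submodule ℂ (E →L[ℂ] E) := (finiteRank E).topologicalClosure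

theorem mem_approximable_of_forall {T : E →L[ℂ] E}
    (h : ∀ ε > 0, ∃ S ∈ approximable E, ‖T - S‖ ≤ ε) : T ∈ approximable E := by
  have hc : IsClosed (approximable E : Set (E →L[ℂ] E)) := Submodule.isClosed_topologicalClosure _
  rw [← SetLike.mem_coe, ← hc.closure_eq, Metric.mem_closure_iff]
  intro ε hε
  obtain ⟨S, hS, hTS⟩ := h (ε / 2) (by positivity)
  exact ⟨S, hS, by rw [dist_eq_norm]; linarith⟩

theorem mul_mem_approximable_left (S : E →L[ℂ] E) {T : E →L[ℂ] E} (hT : T ∈ approximable E) :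
    S * T ∈ approximable E :=
  map_mem_closure (f := fun T => S * T) (by fun_prop) hT fun _ h => mul_mem_finiteRank_left S h

theorem mul_mem_approximable_right (S : E →L[ℂ] E) {T : E →L[ℂ] E} (hT : T ∈ approximable E) :
    T * S ∈ approximable E :=
  map_mem_closure (f := fun T => T * S) (by fun_prop) hT fun _ h => mul_mem_finiteRank_right S h

/-- `T` is invertible up to an approximable operator, with index zero. -/
def AlmostUnit (T : E →L[ℂ] E) : Prop :=
  ∃ G : E →L[ℂ] E, IsUnit G ∧ T - G ∈ approximable E

theorem AlmostUnit.of_isUnit {T : E →L[ℂ] E} (hT : IsUnit T) : AlmostUnit T :=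
  ⟨T, hT, by rw [sub_self]; exact (approximable E).zero_mem⟩

theorem AlmostUnit.congr {S T : E →L[ℂ] E} (hS : AlmostUnit S) (h : T - S ∈ approximable E) :
    AlmostUnit T := by
  obtain ⟨G, hG, hSG⟩ := hS
  exact ⟨G, hG, by simpa using (approximable E).add_mem h hSG⟩

theorem AlmostUnit.mul {S T : E →L[ℂ] E} (hS : AlmostUnit S) (hT : AlmostUnit T) :
    AlmostUnit (S * T) := by
  obtain ⟨G, hG, hSG⟩ := hS
  obtain ⟨H, hH, hTH⟩ := hT
  refine ⟨G * H, hG.mul hH, ?_⟩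
  have h : S * T - G * H = (S - G) * T + G * (T - H) := by noncomm_ring
  rw [h]
  exact (approximable E).add_mem (mul_mem_approximable_right _ hSG)
    (mul_mem_approximable_left _ hTH)

/-- Units form an open set: if `F` has finite rank and is close enough to `T - G`, then `T - F` is
close to `G` and still invertible. So the approximable error can be traded for one of finite rank.
-/
theorem AlmostUnit.indexZero [CompleteSpace E] {T : E →L[ℂ] E} (hT : AlmostUnit T) :
    IndexZero (T : E →ₗ[ℂ] E) := by
  obtain ⟨G, hG, hTG⟩ := hT
  obtain ⟨ε, hε, hball⟩ := Metric.isOpen_iff.mp (Units.isOpen (R := E →L[ℂ] E)) G hG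
  obtain ⟨F, hF, hd⟩ := Metric.mem_closure_iff.mp hTG ε hε
  have hU : IsUnit (T - F) := by
    refine hball ?_
    rw [Metric.mem_ball, dist_eq_norm]
    rw [dist_eq_norm] at hd
    convert hd using 2
    abel
  obtain ⟨u, hu⟩ := hU
  let e : E ≃ₗ[ℂ] E := (ContinuousLinearEquiv.unitsEquiv ℂ E u).toLinearEquiv
  refine ⟨e, ?_⟩
  have h : (T : E →ₗ[ℂ] E) - e.toLinearMap = (F : E →ₗ[ℂ] E) := by
    ext x
    have : e x = (T - F) x := by rw [← hu]; rfl
    simp [this]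
  rw [h]
  exact hF

end Approximable

/-! ### Multiplication operators and Fourier multipliers -/

section Multipliers

open scoped BoundedContinuousFunction FourierTransform

theorem memLp_bcf_mul (φ : ℝ →ᵇ ℂ) (f : L2) : MemLp (fun x => φ x * f x) 2 volume :=
  (Lp.memLp f).of_le_mul (c := ‖φ‖)
    (φ.continuous.aestronglyMeasurable.mul (Lp.aestronglyMeasurable _))
    (Eventually.of_forall fun x => by
      rw [norm_mul]
      gcongr
      exact φ.norm_coe_le_norm x)

theorem L2.ext_of_ae {f g : L2} {F G : ℝ → ℂ} (hf : f =ᵐ[volume] F) (hg : g =ᵐ[volume] G)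
    (h : ∀ᵐ x, F x = G x) : f = g := by
  refine Lp.ext ?_
  filter_upwards [hf, hg, h] with x h1 h2 h3
  rw [h1, h2, h3]

/-- Multiplication by a bounded continuous function, as a bounded operator on `L²`. -/
def mulOpFun (φ : ℝ →ᵇ ℂ) : L2 →L[ℂ] L2 :=
  LinearMap.mkContinuous
    { toFun := fun f => (memLp_bcf_mul φ f).toLp _
      map_add' := fun f g => by
        rw [← MemLp.toLp_add]
        refine (MemLp.toLp_eq_toLp_iff _ _).mpr ?_
        filter_upwards [Lp.coeFn_add f g] with x hx
        rw [hx]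
        exact mul_add _ _ _
      map_smul' := fun c f => by
        rw [RingHom.id_apply, ← MemLp.toLp_const_smul]
        refine (MemLp.toLp_eq_toLp_iff _ _).mpr ?_
        filter_upwards [Lp.coeFn_smul c f] with x hx
        simp [hx, mul_left_comm] }
    ‖φ‖ fun f => by
      refine Lp.norm_le_mul_norm_of_ae_le_mul ?_
      filter_upwards [(memLp_bcf_mul φ f).coeFn_toLp] with x hx
      change ‖(memLp_bcf_mul φ f).toLp _ x‖ ≤ _
      rw [hx, norm_mul]
      gcongr
      exact φ.norm_coe_le_norm x

theorem mulOpFun_coeFn (φ : ℝ →ᵇ ℂ) (f : L2) :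
    mulOpFun φ f =ᵐ[volume] fun x => φ x * f x :=
  (memLp_bcf_mul φ f).coeFn_toLp

theorem mulOpFun_eq {φ : ℝ →ᵇ ℂ} {f g : L2} (h : ∀ᵐ x, φ x * f x = g x) : mulOpFun φ f = g :=
  L2.ext_of_ae (mulOpFun_coeFn φ f) (EventuallyEq.refl _ _) h

/-- Multiplication by bounded continuous functions, as an algebra homomorphism. -/
def mulOp : (ℝ →ᵇ ℂ) →ₐ[ℂ] (L2 →L[ℂ] L2) :=
  AlgHom.ofLinearMap
    { toFun := mulOpFun
      map_add' := fun φ ψ => by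
        ext1 f
        refine mulOpFun_eq ?_
        filter_upwards [Lp.coeFn_add (mulOpFun φ f) (mulOpFun ψ f), mulOpFun_coeFn φ f,
          mulOpFun_coeFn ψ f] with x h1 h2 h3
        change (φ x + ψ x) * f x = (mulOpFun φ f + mulOpFun ψ f : L2) x
        rw [h1, Pi.add_apply, h2, h3, add_mul]
      map_smul' := fun c φ => by
        ext1 f
        refine mulOpFun_eq ?_
        filter_upwards [Lp.coeFn_smul c (mulOpFun φ f), mulOpFun_coeFn φ f] with x h1 h2
        change (c * φ x) * f x = (c • mulOpFun φ f : L2) x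
        rw [h1, Pi.smul_apply, h2, smul_eq_mul, mul_assoc] }
    (by
      ext1 f
      exact mulOpFun_eq (Eventually.of_forall fun x => by simp))
    (fun φ ψ => by
      ext1 f
      refine mulOpFun_eq ?_
      filter_upwards [mulOpFun_coeFn φ (mulOpFun ψ f), mulOpFun_coeFn ψ f] with x h1 h2
      change _ = mulOpFun φ (mulOpFun ψ f) x
      rw [h1, h2]
      simp [mul_assoc])

theorem mulOp_coeFn (φ : ℝ →ᵇ ℂ) (f : L2) : mulOp φ f =ᵐ[volume] fun x => φ x * f x :=
  mulOpFun_coeFn φ f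

theorem norm_mulOp_le (φ : ℝ →ᵇ ℂ) : ‖mulOp φ‖ ≤ ‖φ‖ :=
  (mulOpFun φ).opNorm_le_bound (norm_nonneg _) fun f => by
    refine Lp.norm_le_mul_norm_of_ae_le_mul ?_
    filter_upwards [mulOpFun_coeFn φ f] with x hx
    rw [hx, norm_mul]
    gcongr
    exact φ.norm_coe_le_norm x

/-- The Fourier multiplier `m(D)` on `L²` with a bounded continuous symbol `m`. -/
def fmul : (ℝ →ᵇ ℂ) →ₐ[ℂ] (L2 →L[ℂ] L2) :=
  ((Lp.fourierTransformₗᵢ ℝ ℂ).symm.toContinuousLinearEquiv.conjContinuousAlgEquiv :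
    (L2 →L[ℂ] L2) →ₐ[ℂ] (L2 →L[ℂ] L2)).comp mulOp

theorem fmul_apply (m : ℝ →ᵇ ℂ) (f : L2) : fmul m f = 𝓕⁻ (mulOp m (𝓕 f)) := rfl

theorem norm_fmul_apply (m : ℝ →ᵇ ℂ) (f : L2) : ‖fmul m f‖ = ‖mulOp m (𝓕 f)‖ := by
  rw [fmul_apply]
  exact (Lp.fourierTransformₗᵢ ℝ ℂ).symm.norm_map _

theorem norm_fmul_le (m : ℝ →ᵇ ℂ) : ‖fmul m‖ ≤ ‖m‖ := by
  refine ContinuousLinearMap.opNorm_le_bound _ (norm_nonneg _) fun f => ?_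
  rw [norm_fmul_apply, ← Lp.norm_fourier_eq f]
  exact (mulOp m).le_of_opNorm_le (norm_mulOp_le m) _

theorem mulOp_toDistribution (φ : ℝ →ᵇ ℂ) (hφ : Function.HasTemperateGrowth φ) (f : L2) :
    (mulOp φ f : 𝓢'(ℝ, ℂ)) = TemperedDistribution.smulLeftCLM ℂ φ (f : 𝓢'(ℝ, ℂ)) := by
  ext u
  simp only [Lp.toTemperedDistribution_apply, TemperedDistribution.smulLeftCLM_apply_apply]
  refine integral_congr_ae ?_
  filter_upwards [mulOp_coeFn φ f] with x hx
  rw [hx, SchwartzMap.smulLeftCLM_apply_apply hφ]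
  simp only [smul_eq_mul]
  ring

/-- The bridge from `L²` multipliers to tempered distributions, where weak derivatives and Sobolev
regularity are defined. -/
theorem fmul_toDistribution (m : ℝ →ᵇ ℂ) (hm : Function.HasTemperateGrowth m) (f : L2) :
    (fmul m f : 𝓢'(ℝ, ℂ)) = TemperedDistribution.fourierMultiplierCLM ℂ m (f : 𝓢'(ℝ, ℂ)) := by
  rw [fmul_apply, TemperedDistribution.fourierMultiplierCLM_apply,
    Lp.fourier_toTemperedDistribution_eq, ← mulOp_toDistribution m hm,
    Lp.fourierInv_toTemperedDistribution_eq]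

theorem mulOp_toLp (φ : ℝ →ᵇ ℂ) (hφ : Function.HasTemperateGrowth φ) (f : 𝓢(ℝ, ℂ)) :
    mulOp φ (f.toLp 2) = (SchwartzMap.smulLeftCLM ℂ φ f).toLp 2 := by
  refine L2.ext_of_ae (mulOp_coeFn φ _) (SchwartzMap.coeFn_toLp _ 2 volume) ?_
  filter_upwards [f.coeFn_toLp 2] with x hx
  rw [hx, SchwartzMap.smulLeftCLM_apply_apply hφ, smul_eq_mul]

theorem fmul_toLp (m : ℝ →ᵇ ℂ) (hm : Function.HasTemperateGrowth m) (f : 𝓢(ℝ, ℂ)) :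
    fmul m (f.toLp 2) = (SchwartzMap.fourierMultiplierCLM ℂ m f).toLp 2 := by
  rw [fmul_apply, SchwartzMap.toLp_fourier_eq, mulOp_toLp m hm, SchwartzMap.toLp_fourierInv_eq,
    SchwartzMap.fourierMultiplierCLM_apply]

/-- Two bounded operators on `L²` agree if they agree on Schwartz functions. -/
theorem ext_on_schwartz {S T : L2 →L[ℂ] L2} (h : ∀ f : 𝓢(ℝ, ℂ), S (f.toLp 2) = T (f.toLp 2)) :
    S = T := by
  have hd : DenseRange (SchwartzMap.toLpCLM ℝ (E := ℝ) ℂ 2 volume) :=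
    SchwartzMap.denseRange_toLpCLM ENNReal.ofNat_ne_top
  exact DFunLike.coe_injective (hd.equalizer S.continuous T.continuous (funext h))

/-- A bound for an operator on `L²` can be checked on Schwartz functions. -/
theorem norm_le_of_schwartz {T : L2 →L[ℂ] L2} {C : ℝ} (hC : 0 ≤ C)
    (h : ∀ f : 𝓢(ℝ, ℂ), ‖T (f.toLp 2)‖ ≤ C * ‖f.toLp 2‖) : ‖T‖ ≤ C := by
  have hd : DenseRange (SchwartzMap.toLpCLM ℝ (E := ℝ) ℂ 2 volume) :=
    SchwartzMap.denseRange_toLpCLM ENNReal.ofNat_ne_top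
  refine T.opNorm_le_bound hC fun f => ?_
  refine hd.induction_on (p := fun f => ‖T f‖ ≤ C * ‖f‖) f ?_ h
  exact isClosed_le (by fun_prop) (by fun_prop)

end Multipliers

/-! ### Approximability of `φ(x) m(D)` -/

section Compactness

open scoped BoundedContinuousFunction FourierTransform

/-- Weierstrass M-test with majorant `Cᵏ / k!`. -/
theorem exists_exp_taylor_uniform (C : ℝ) {ε : ℝ} (hε : 0 < ε) :
    ∃ K : ℕ, ∀ z : ℂ, ‖z‖ ≤ C →
      ‖Complex.exp z - ∑ k ∈ Finset.range K, z ^ k / (k.factorial : ℂ)‖ ≤ ε := by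
  have h : TendstoUniformlyOn
      (fun N (z : ℂ) => ∑ k ∈ Finset.range N, z ^ k / (k.factorial : ℂ))
      (fun z => ∑' k, z ^ k / (k.factorial : ℂ)) atTop {z | ‖z‖ ≤ C} := by
    refine tendstoUniformlyOn_tsum_nat (u := fun k => C ^ k / k.factorial)
      (Real.summable_pow_div_factorial C) fun k z hz => ?_
    rw [norm_div, norm_pow, Complex.norm_natCast]
    gcongr
    exact hz
  obtain ⟨K, hK⟩ := (Metric.tendstoUniformlyOn_iff.mp h ε hε).exists
  refine ⟨K, fun z hz => ?_⟩
  have h1 := (hK z hz).le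
  rwa [dist_eq_norm, ← congrFun NormedSpace.exp_eq_tsum_div z, ← Complex.exp_eq_exp_ℂ] at h1

/-- Cauchy-Schwarz, as Hölder's inequality for the `L¹` norm of the product. -/
theorem integral_norm_mul_norm_le (f g : L2) : ∫ x, ‖f x‖ * ‖g x‖ ≤ ‖f‖ * ‖g‖ := by
  have h := Lp.norm_smul_le (r := 1) f g
  rw [L1.norm_eq_integral_norm] at h
  refine le_trans (le_of_eq (integral_congr_ae ?_)) h
  filter_upwards [Lp.coeFn_lpSMul (r := 1) f g] with x hx
  rw [hx]
  simp

/-- The rank-one operator `f ↦ (∫ b 𝓕f) a`. -/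
def rankOne (a b : L2) : L2 →L[ℂ] L2 :=
  (((ContinuousLinearMap.mul ℂ ℂ).lpPairing volume 2 2 b) ∘L
    (Lp.fourierTransformₗᵢ ℝ ℂ : L2 →L[ℂ] L2)).smulRight a

theorem rankOne_apply (a b f : L2) : rankOne a b f = (∫ ξ, b ξ * (𝓕 f : L2) ξ) • a := by
  change ((ContinuousLinearMap.mul ℂ ℂ).lpPairing volume 2 2 b (𝓕 f : L2)) • a = _
  rw [ContinuousLinearMap.lpPairing_eq_integral]
  rfl

theorem rankOne_mem (a b : L2) : rankOne a b ∈ finiteRank L2 := by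
  refine Submodule.finiteDimensional_of_le (S₂ := Submodule.span ℂ {a}) ?_
  rintro _ ⟨f, rfl⟩
  exact Submodule.mem_span_singleton.mpr ⟨_, rfl⟩

theorem hasTemperateGrowth_ofReal_pow (k : ℕ) :
    Function.HasTemperateGrowth fun x : ℝ => (x : ℂ) ^ k := by
  fun_prop

theorem mulOp_mul_fmul_toLp (a b f : 𝓢(ℝ, ℂ)) :
    (mulOp a.toBoundedContinuousFunction * fmul b.toBoundedContinuousFunction) (f.toLp 2)
      =ᵐ[volume] fun x => a x * ∫ ξ : ℝ,
        Complex.exp (2 * Real.pi * Complex.I * x * ξ) * (b ξ * 𝓕 f ξ) := by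
  have h : (mulOp a.toBoundedContinuousFunction * fmul b.toBoundedContinuousFunction) (f.toLp 2) =
      (SchwartzMap.smulLeftCLM ℂ a (SchwartzMap.fourierMultiplierCLM ℂ b f)).toLp 2 := by
    rw [mul_apply_eq_comp, fmul_toLp _ b.hasTemperateGrowth,
      mulOp_toLp _ a.hasTemperateGrowth]
    rfl
  rw [h]
  refine (SchwartzMap.coeFn_toLp _ 2 volume).trans (Eventually.of_forall fun x => ?_)
  simp only []
  rw [SchwartzMap.smulLeftCLM_apply_apply a.hasTemperateGrowth,
    SchwartzMap.fourierMultiplierCLM_apply, SchwartzMap.fourierInv_coe, Real.fourierInv_eq',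
    smul_eq_mul]
  congr 1
  refine integral_congr_ae (Eventually.of_forall fun ξ => ?_)
  simp only [smul_eq_mul]
  rw [SchwartzMap.smulLeftCLM_apply_apply b.hasTemperateGrowth, smul_eq_mul]
  congr 2
  simp
  ring

/-- Multiplication of a Schwartz function by `xᵏ`. -/
def powMul (k : ℕ) (f : 𝓢(ℝ, ℂ)) : 𝓢(ℝ, ℂ) := SchwartzMap.smulLeftCLM ℂ (fun x : ℝ => (x : ℂ) ^ k) f

theorem powMul_apply (k : ℕ) (f : 𝓢(ℝ, ℂ)) (x : ℝ) : powMul k f x = (x : ℂ) ^ k * f x :=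
  SchwartzMap.smulLeftCLM_apply_apply (hasTemperateGrowth_ofReal_pow k) f x

theorem rankOne_powMul (a b f : 𝓢(ℝ, ℂ)) (k : ℕ) :
    rankOne ((powMul k a).toLp 2) ((powMul k b).toLp 2) (f.toLp 2)
      =ᵐ[volume] fun x => (x : ℂ) ^ k * a x * ∫ ξ : ℝ, (ξ : ℂ) ^ k * (b ξ * 𝓕 f ξ) := by
  have hint : ∫ ξ, (powMul k b).toLp 2 volume ξ * (𝓕 (f.toLp 2 volume) : L2) ξ =
      ∫ ξ : ℝ, (ξ : ℂ) ^ k * (b ξ * 𝓕 f ξ) := by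
    refine integral_congr_ae ?_
    rw [SchwartzMap.toLp_fourier_eq]
    filter_upwards [(powMul k b).coeFn_toLp 2 volume, (𝓕 f).coeFn_toLp 2 volume] with ξ h1 h2
    rw [h1, h2, powMul_apply, mul_assoc]
  rw [rankOne_apply, hint]
  filter_upwards [Lp.coeFn_smul (∫ ξ : ℝ, (ξ : ℂ) ^ k * (b ξ * 𝓕 f ξ)) ((powMul k a).toLp 2 volume),
    (powMul k a).coeFn_toLp 2 volume] with x h1 h2
  rw [h1, Pi.smul_apply, h2, powMul_apply, smul_eq_mul, mul_comm]

theorem L2.coeFn_sum_smul {ι : Type*} (s : Finset ι) (c : ι → ℂ) (F : ι → L2) (G : ι → ℝ → ℂ)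
    (h : ∀ i, F i =ᵐ[volume] G i) :
    (∑ i ∈ s, c i • F i : L2) =ᵐ[volume] fun x => ∑ i ∈ s, c i * G i x := by
  classical
  induction s using Finset.induction_on with
  | empty =>
    simp only [Finset.sum_empty]
    exact Lp.coeFn_zero _ _ _
  | insert i s hi ih =>
    rw [Finset.sum_insert hi]
    filter_upwards [Lp.coeFn_add (c i • F i) (∑ i ∈ s, c i • F i), ih, Lp.coeFn_smul (c i) (F i),
      h i] with x h1 h2 h3 h4
    rw [h1, Pi.add_apply, h2, h3, Pi.smul_apply, h4, Finset.sum_insert hi, smul_eq_mul]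

/-- The finite-rank operator obtained from `a(x) b(D)` by truncating the Taylor series of the kernel
`exp (2 π i x ξ)`. -/
def taylorOp (a b : 𝓢(ℝ, ℂ)) (K : ℕ) : L2 →L[ℂ] L2 :=
  ∑ k ∈ Finset.range K, ((2 * Real.pi * Complex.I) ^ k / (k.factorial : ℂ)) •
    rankOne ((powMul k a).toLp 2) ((powMul k b).toLp 2)

theorem taylorOp_mem (a b : 𝓢(ℝ, ℂ)) (K : ℕ) : taylorOp a b K ∈ approximable L2 :=
  Submodule.sum_mem _ fun _ _ => Submodule.smul_mem _ _
    (Submodule.le_topologicalClosure _ (rankOne_mem _ _))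

theorem integrable_pow_mul (b f : 𝓢(ℝ, ℂ)) (k : ℕ) :
    Integrable fun ξ : ℝ => (ξ : ℂ) ^ k * (b ξ * f ξ) := by
  have h := (powMul k (SchwartzMap.smulLeftCLM ℂ b f)).integrable (μ := volume)
  refine h.congr (Eventually.of_forall fun ξ => ?_)
  simp only []
  rw [powMul_apply, SchwartzMap.smulLeftCLM_apply_apply b.hasTemperateGrowth, smul_eq_mul]

theorem taylorOp_toLp (a b f : 𝓢(ℝ, ℂ)) (K : ℕ) :
    taylorOp a b K (f.toLp 2) =ᵐ[volume] fun x => a x * ∫ ξ : ℝ,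
      (∑ k ∈ Finset.range K, (2 * Real.pi * Complex.I * x * ξ) ^ k / (k.factorial : ℂ)) *
        (b ξ * 𝓕 f ξ) := by
  have hs : taylorOp a b K (f.toLp 2) = ∑ k ∈ Finset.range K,
      ((2 * Real.pi * Complex.I) ^ k / (k.factorial : ℂ)) •
        rankOne ((powMul k a).toLp 2) ((powMul k b).toLp 2) (f.toLp 2) := by
    rw [taylorOp, sum_apply]
    rfl
  rw [hs]
  refine (L2.coeFn_sum_smul _ _ _ _ fun k => rankOne_powMul a b f k).trans
    (Eventually.of_forall fun x => ?_)
  simp only [Finset.sum_mul]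
  rw [integral_finsetSum, Finset.mul_sum]
  · refine Finset.sum_congr rfl fun k _ => ?_
    have e : ∀ ξ : ℝ, (2 * Real.pi * Complex.I * x * ξ) ^ k / (k.factorial : ℂ) * (b ξ * 𝓕 f ξ) =
        ((2 * Real.pi * Complex.I) ^ k / (k.factorial : ℂ) * (x : ℂ) ^ k) *
          ((ξ : ℂ) ^ k * (b ξ * 𝓕 f ξ)) := fun ξ => by ring
    simp only [e]
    rw [integral_const_mul]
    ring
  · intro k _
    refine ((integrable_pow_mul b (𝓕 f) k).const_mul
      ((2 * Real.pi * Complex.I * x) ^ k / (k.factorial : ℂ))).congr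
      (Eventually.of_forall fun ξ => ?_)
    simp only []
    ring

/-- As an operator on `𝓕 f`, `a(x) b(D)` has kernel `a(x) exp(2πi x ξ) b(ξ)`. On the supports of `a`
and `b` the exponent is bounded by `2πN²`, so a Taylor polynomial approximates the exponential
uniformly; each of its terms is a product of a function of `x` and one of `ξ`. Cauchy-Schwarz in `ξ`
turns the uniform error into a norm bound. -/
theorem norm_sub_taylorOp_le (a b : 𝓢(ℝ, ℂ)) {N δ : ℝ} (hN : 0 ≤ N) (ha : ∀ x, N < |x| → a x = 0)
    (hb : ∀ x, N < |x| → b x = 0) (hδ : 0 < δ) {K : ℕ}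
    (hK : ∀ z : ℂ, ‖z‖ ≤ 2 * Real.pi * (N * N) →
      ‖Complex.exp z - ∑ k ∈ Finset.range K, z ^ k / (k.factorial : ℂ)‖ ≤ δ) :
    ‖mulOp a.toBoundedContinuousFunction * fmul b.toBoundedContinuousFunction - taylorOp a b K‖ ≤
      δ * (‖a.toLp 2‖ * ‖b.toLp 2‖) := by
  refine norm_le_of_schwartz (by positivity) fun f => ?_
  have hbf : ∫ ξ, ‖b ξ‖ * ‖𝓕 f ξ‖ ≤ ‖b.toLp 2‖ * ‖f.toLp 2‖ := by
    have h := integral_norm_mul_norm_le (b.toLp 2) (𝓕 (f.toLp 2) : L2)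
    rw [Lp.norm_fourier_eq, SchwartzMap.toLp_fourier_eq] at h
    refine le_trans (le_of_eq (integral_congr_ae ?_)) h
    filter_upwards [b.coeFn_toLp 2 volume, (𝓕 f).coeFn_toLp 2 volume] with x h1 h2
    rw [h1, h2]
  have hint : Integrable fun ξ => b ξ * 𝓕 f ξ := by
    simpa using integrable_pow_mul b (𝓕 f) 0
  have hle : ‖(mulOp a.toBoundedContinuousFunction * fmul b.toBoundedContinuousFunction -
      taylorOp a b K) (f.toLp 2)‖ ≤ (δ * (‖b.toLp 2‖ * ‖f.toLp 2‖)) * ‖a.toLp 2‖ := by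
    refine Lp.norm_le_mul_norm_of_ae_le_mul ?_
    rw [sub_apply]
    filter_upwards [Lp.coeFn_sub ((mulOp a.toBoundedContinuousFunction *
      fmul b.toBoundedContinuousFunction) (f.toLp 2)) (taylorOp a b K (f.toLp 2)),
      mulOp_mul_fmul_toLp a b f, taylorOp_toLp a b f K, a.coeFn_toLp 2 volume] with x h1 h2 h3 h4
    rw [h1, Pi.sub_apply, h2, h3, h4, ← mul_sub, norm_mul, mul_comm]
    by_cases hx : N < |x|
    · simp [ha x hx]
    gcongr
    have hpow : ∀ k : ℕ, Integrable fun ξ : ℝ =>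
        (2 * Real.pi * Complex.I * x * ξ) ^ k / (k.factorial : ℂ) * (b ξ * 𝓕 f ξ) := fun k => by
      refine ((integrable_pow_mul b (𝓕 f) k).const_mul
        ((2 * Real.pi * Complex.I * x) ^ k / (k.factorial : ℂ))).congr
        (Eventually.of_forall fun ξ => ?_)
      simp only []
      ring
    rw [← integral_sub]
    · refine le_trans (norm_integral_le_integral_norm _) ?_
      refine le_trans (integral_mono_of_nonneg (g := fun ξ => δ * (‖b ξ‖ * ‖𝓕 f ξ‖))
        (Eventually.of_forall fun _ => norm_nonneg _) ?_ (Eventually.of_forall fun ξ => ?_)) ?_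
      · simpa using hint.norm.const_mul δ
      · simp only []
        rw [← sub_mul, norm_mul, norm_mul]
        by_cases hξ : N < |ξ|
        · simp [hb ξ hξ]
        gcongr
        refine hK _ ?_
        simp only [norm_mul, Complex.norm_real, Complex.norm_I, Real.norm_eq_abs, Complex.norm_ofNat,
          abs_of_pos Real.pi_pos, mul_one]
        push Not at hx hξ
        rw [mul_assoc]
        gcongr
      · rw [integral_const_mul]
        gcongr
    · refine hint.bdd_mul (c := 1) (by fun_prop) (Eventually.of_forall fun ξ => ?_)
      rw [show 2 * (Real.pi : ℂ) * Complex.I * x * ξ = ((2 * Real.pi * x * ξ : ℝ) : ℂ) * Complex.I by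
        push_cast; ring, Complex.norm_exp_ofReal_mul_I]
    · simp only [Finset.sum_mul]
      exact integrable_finsetSum _ fun k _ => hpow k
  refine hle.trans (le_of_eq (by ring))

/-- The operators `a(x) b(D)` are approximable if `a` and `b` are test functions. -/
theorem mulOp_mul_fmul_mem_of_schwartz (a b : 𝓢(ℝ, ℂ)) {N : ℝ} (hN : 0 ≤ N)
    (ha : ∀ x, N < |x| → a x = 0) (hb : ∀ x, N < |x| → b x = 0) :
    mulOp a.toBoundedContinuousFunction * fmul b.toBoundedContinuousFunction ∈
      approximable L2 := by
  refine mem_approximable_of_forall fun ε hε => ?_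
  have hδ : 0 < ε / (‖a.toLp 2‖ * ‖b.toLp 2‖ + 1) := by positivity
  obtain ⟨K, hK⟩ := exists_exp_taylor_uniform (2 * Real.pi * (N * N)) hδ
  refine ⟨taylorOp a b K, taylorOp_mem a b K, (norm_sub_taylorOp_le a b hN ha hb hδ hK).trans ?_⟩
  rw [div_mul_eq_mul_div, div_le_iff₀ (by positivity)]
  nlinarith

/-- A bounded continuous function vanishing at infinity is uniformly close to its product with a
test function. -/
theorem exists_cutoff (φ : ℝ →ᵇ ℂ) (hφ : Tendsto φ (cocompact ℝ) (𝓝 0)) {ε : ℝ} (hε : 0 < ε) :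
    ∃ (a : 𝓢(ℝ, ℂ)) (N : ℝ), 0 ≤ N ∧ (∀ x, N < |x| → a x = 0) ∧
      ‖a.toBoundedContinuousFunction‖ ≤ 1 ∧ ‖φ - φ * a.toBoundedContinuousFunction‖ ≤ ε := by
  have h1 := Metric.tendsto_nhds.mp hφ ε hε
  rw [← Metric.cobounded_eq_cocompact, Filter.eventually_iff,
    ← Bornology.isCobounded_def, ← Bornology.isBounded_compl_iff, isBounded_iff_forall_norm_le] at h1
  obtain ⟨C, hC⟩ := h1
  -- Every point with `‖φ x‖ ≥ ε` satisfies `|x| ≤ C`, so the bump equals `1` there. The absolute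
  -- value guards against a negative `C`.
  let β : ContDiffBump (0 : ℝ) := ⟨|C| + 1, |C| + 2, by positivity, by linarith⟩
  have hs : HasCompactSupport fun x => (β x : ℂ) := β.hasCompactSupport.comp_left (g := Complex.ofReal) rfl
  have hc : ContDiff ℝ ∞ fun x => (β x : ℂ) := Complex.ofRealCLM.contDiff.comp β.contDiff
  refine ⟨hs.toSchwartzMap hc, |C| + 2, by positivity, fun x hx => ?_, ?_, ?_⟩
  · change (β x : ℂ) = 0
    rw [β.zero_of_le_dist, Complex.ofReal_zero]
    rw [Real.dist_eq, sub_zero]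
    exact hx.le
  · refine (BoundedContinuousFunction.norm_le zero_le_one).mpr fun x => ?_
    change ‖(β x : ℂ)‖ ≤ 1
    rw [Complex.norm_real, Real.norm_of_nonneg β.nonneg]
    exact β.le_one
  · refine (BoundedContinuousFunction.norm_le hε.le).mpr fun x => ?_
    change ‖φ x - φ x * (β x : ℂ)‖ ≤ ε
    by_cases hx : |x| ≤ |C| + 1
    · rw [β.one_of_mem_closedBall (by simpa using hx)]
      simp [hε.le]
    · have hx' : dist (φ x) 0 < ε := by
        by_contra hcon
        have := hC x hcon
        rw [Real.norm_eq_abs] at this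
        have := le_abs_self C
        linarith
      rw [dist_zero_right] at hx'
      have h2 : φ x - φ x * (β x : ℂ) = φ x * ((1 - β x : ℝ) : ℂ) := by push_cast; ring
      rw [h2, norm_mul, Complex.norm_real, Real.norm_of_nonneg (by linarith [β.le_one (x := x)])]
      have := β.nonneg (x := x)
      nlinarith [norm_nonneg (φ x)]

/-- The operators `φ(x) m(D)` are approximable if `φ` and `m` vanish at infinity. -/
theorem mulOp_mul_fmul_mem (φ m : ℝ →ᵇ ℂ) (hφ : Tendsto φ (cocompact ℝ) (𝓝 0))
    (hm : Tendsto m (cocompact ℝ) (𝓝 0)) : mulOp φ * fmul m ∈ approximable L2 := by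
  refine mem_approximable_of_forall fun ε hε => ?_
  obtain ⟨a, N₁, hN₁, ha, ha1, haε⟩ := exists_cutoff φ hφ
    (show 0 < ε / (2 * (‖m‖ + 1)) by positivity)
  obtain ⟨b, N₂, hN₂, hb, -, hbε⟩ := exists_cutoff m hm
    (show 0 < ε / (2 * (‖φ‖ + 1)) by positivity)
  set a' := a.toBoundedContinuousFunction
  set b' := b.toBoundedContinuousFunction
  have hab : mulOp (φ * a') * fmul (m * b') ∈ approximable L2 := by
    rw [mul_comm m b', map_mul, map_mul]
    have h := mulOp_mul_fmul_mem_of_schwartz a b (N := max N₁ N₂) (le_max_of_le_left hN₁)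
      (fun x hx => ha x (lt_of_le_of_lt (le_max_left _ _) hx))
      (fun x hx => hb x (lt_of_le_of_lt (le_max_right _ _) hx))
    have := mul_mem_approximable_left (mulOp φ) (mul_mem_approximable_right (fmul m) h)
    simpa only [mul_assoc] using this
  refine ⟨_, hab, ?_⟩
  -- The two cutoffs are inserted one at a time; each costs at most `ε / 2`.
  have e : mulOp φ * fmul m - mulOp (φ * a') * fmul (m * b') =
      mulOp (φ - φ * a') * fmul m + mulOp (φ * a') * fmul (m - m * b') := by
    simp only [map_sub]
    noncomm_ring
  have hφa : ‖φ * a'‖ ≤ ‖φ‖ := by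
    refine (norm_mul_le _ _).trans ?_
    nlinarith [norm_nonneg φ]
  rw [e]
  refine (norm_add_le _ _).trans ?_
  have h1 : ‖mulOp (φ - φ * a') * fmul m‖ ≤ ε / (2 * (‖m‖ + 1)) * ‖m‖ :=
    (norm_mul_le _ _).trans (mul_le_mul ((norm_mulOp_le _).trans haε) (norm_fmul_le m)
      (norm_nonneg _) (by positivity))
  have h2 : ‖mulOp (φ * a') * fmul (m - m * b')‖ ≤ ‖φ‖ * (ε / (2 * (‖φ‖ + 1))) :=
    (norm_mul_le _ _).trans (mul_le_mul ((norm_mulOp_le _).trans hφa) ((norm_fmul_le _).trans hbε)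
      (norm_nonneg _) (by positivity))
  have h3 : ε / (2 * (‖m‖ + 1)) * ‖m‖ ≤ ε / 2 := by
    rw [div_mul_eq_mul_div, div_le_div_iff₀ (by positivity) (by positivity)]
    nlinarith [norm_nonneg m]
  have h4 : ‖φ‖ * (ε / (2 * (‖φ‖ + 1))) ≤ ε / 2 := by
    rw [mul_div_assoc', div_le_div_iff₀ (by positivity) (by positivity)]
    nlinarith [norm_nonneg φ]
  linarith

end Compactness

/-! ### The commutator of a cutoff function with Fourier multipliers -/

section Commutator

open scoped BoundedContinuousFunction FourierTransform

theorem one_add_mul_I_ne_zero (x : ℝ) : 1 + (x : ℂ) * Complex.I ≠ 0 := fun h => by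
  simpa using congrArg Complex.re h

theorem norm_one_add_mul_I_sq (x : ℝ) : ‖1 + (x : ℂ) * Complex.I‖ ^ 2 = 1 + ‖x‖ ^ 2 := by
  rw [← Complex.normSq_eq_norm_sq]
  simp [Complex.normSq_apply]
  ring

/-- The symbol `(1 + i ξ)⁻¹`. -/
def resSymbol : ℝ →ᵇ ℂ :=
  BoundedContinuousFunction.ofNormedAddCommGroup (fun x : ℝ => (1 + (x : ℂ) * Complex.I)⁻¹)
    (Continuous.inv₀ (by fun_prop) one_add_mul_I_ne_zero) 1 fun x => by
      rw [norm_inv]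
      refine inv_le_one_of_one_le₀ ?_
      have := norm_one_add_mul_I_sq x
      nlinarith [norm_nonneg (1 + (x : ℂ) * Complex.I), sq_nonneg ‖x‖]

theorem resSymbol_apply (x : ℝ) : resSymbol x = (1 + (x : ℂ) * Complex.I)⁻¹ := rfl

theorem resSymbol_ne_zero (x : ℝ) : resSymbol x ≠ 0 := inv_ne_zero (one_add_mul_I_ne_zero x)

theorem hasTemperateGrowth_resSymbol : Function.HasTemperateGrowth resSymbol := by
  -- Rationalizing the denominator leaves a polynomial times a real power of `1 + ‖x‖²`, both of
  -- temperate growth.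
  have h : (resSymbol : ℝ → ℂ) = fun x : ℝ =>
      (1 - (x : ℂ) * Complex.I) * ((((1 + ‖x‖ ^ 2) ^ (-1 : ℝ) : ℝ)) : ℂ) := by
    ext x
    rw [resSymbol_apply, Real.rpow_neg_one, ← norm_one_add_mul_I_sq, ← Complex.normSq_eq_norm_sq,
      Complex.inv_def]
    congr 1
    simp [sub_eq_add_neg]
  rw [h]
  fun_prop

theorem tendsto_resSymbol : Tendsto resSymbol (cocompact ℝ) (𝓝 0) := by
  rw [tendsto_zero_iff_norm_tendsto_zero]
  have h : Tendsto (fun x : ℝ => ‖x‖⁻¹) (cocompact ℝ) (𝓝 0) :=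
    tendsto_inv_atTop_zero.comp (tendsto_norm_cocompact_atTop (E := ℝ))
  have hne : ∀ᶠ x in cocompact ℝ, x ≠ (0 : ℝ) := by
    have := (isCompact_singleton (x := (0 : ℝ))).compl_mem_cocompact
    exact this
  refine squeeze_zero' (Eventually.of_forall fun _ => norm_nonneg _) ?_ h
  filter_upwards [hne] with x hx
  rw [resSymbol_apply, norm_inv]
  have := norm_one_add_mul_I_sq x
  gcongr
  refine le_of_sq_le_sq ?_ (norm_nonneg _)
  linarith

/-- A smooth cutoff function that is `0` on `(-∞, 0]` and `1` on `[1, ∞)`. -/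
def cutoff : ℝ →ᵇ ℂ :=
  BoundedContinuousFunction.ofNormedAddCommGroup (fun x : ℝ => (Real.smoothTransition x : ℂ))
    (Complex.continuous_ofReal.comp Real.smoothTransition.continuous) 1 fun x => by
      rw [Complex.norm_real, Real.norm_of_nonneg (Real.smoothTransition.nonneg x)]
      exact Real.smoothTransition.le_one x

theorem cutoff_apply (x : ℝ) : cutoff x = (Real.smoothTransition x : ℂ) := rfl

theorem cutoff_of_nonpos {x : ℝ} (hx : x ≤ 0) : cutoff x = 0 := by
  rw [cutoff_apply, Real.smoothTransition.zero_of_nonpos hx, Complex.ofReal_zero]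

theorem cutoff_of_one_le {x : ℝ} (hx : 1 ≤ x) : cutoff x = 1 := by
  rw [cutoff_apply, Real.smoothTransition.one_of_one_le hx, Complex.ofReal_one]

theorem norm_cutoff_le : ‖cutoff‖ ≤ 1 :=
  BoundedContinuousFunction.norm_ofNormedAddCommGroup_le _ zero_le_one _

theorem contDiff_cutoff : ContDiff ℝ ∞ cutoff :=
  Complex.ofRealCLM.contDiff.comp Real.smoothTransition.contDiff

theorem hasCompactSupport_fderiv_cutoff : HasCompactSupport (fderiv ℝ cutoff) := by
  refine HasCompactSupport.intro (isCompact_Icc (a := (0 : ℝ)) (b := 1)) fun x hx => ?_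
  rw [Set.mem_Icc, not_and_or, not_le, not_le] at hx
  rcases hx with hx | hx
  · have h : cutoff =ᶠ[𝓝 x] fun _ => (0 : ℂ) := by
      filter_upwards [eventually_lt_nhds hx] with y hy
      exact cutoff_of_nonpos hy.le
    rw [h.fderiv_eq]
    simp
  · have h : cutoff =ᶠ[𝓝 x] fun _ => (1 : ℂ) := by
      filter_upwards [eventually_gt_nhds hx] with y hy
      exact cutoff_of_one_le hy.le
    rw [h.fderiv_eq]
    simp

theorem hasTemperateGrowth_cutoff : Function.HasTemperateGrowth cutoff := by
  refine Function.HasTemperateGrowth.of_fderiv (k := 0) (C := 1)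
    (hasCompactSupport_fderiv_cutoff.hasTemperateGrowth ?_) ?_ fun x => ?_
  · exact contDiff_cutoff.fderiv_right (by simp)
  · exact contDiff_cutoff.differentiable (by simp)
  · simpa using (cutoff.norm_coe_le_norm x).trans norm_cutoff_le

theorem hasCompactSupport_deriv_cutoff : HasCompactSupport (deriv cutoff) := by
  have h := hasCompactSupport_fderiv_cutoff.comp_left (g := fun L : ℝ →L[ℝ] ℂ => L 1) (by simp)
  exact h

/-- The derivative of the cutoff function. -/
def cutoffDeriv : 𝓢(ℝ, ℂ) :=
  hasCompactSupport_deriv_cutoff.toSchwartzMap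
    ((contDiff_infty_iff_deriv.mp contDiff_cutoff).2)

theorem cutoffDeriv_apply (x : ℝ) : cutoffDeriv x = deriv cutoff x := rfl

/-- With the Fourier normalization `∂ₓ ↔ 2πiξ`, the factor `(2π)⁻¹` gives the operator the symbol `1
+ iξ`, so that `resSymbol` is its inverse. -/
theorem fourier_add_deriv (ψ : 𝓢(ℝ, ℂ)) (ξ : ℝ) :
    𝓕 (ψ + ((2 * Real.pi : ℂ)⁻¹) • ∂_{(1 : ℝ)} ψ) ξ = (1 + (ξ : ℂ) * Complex.I) * 𝓕 ψ ξ := by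
  rw [FourierTransform.fourier_add, FourierTransform.fourier_smul,
    SchwartzMap.fourier_lineDerivOp_eq, add_apply, smul_apply,
    smul_apply, SchwartzMap.smulLeftCLM_apply_apply (by fun_prop)]
  have : (Real.pi : ℂ) ≠ 0 := by exact_mod_cast Real.pi_ne_zero
  simp
  field_simp

theorem fourierMultiplier_resSymbol_add_deriv (ψ : 𝓢(ℝ, ℂ)) :
    SchwartzMap.fourierMultiplierCLM ℂ resSymbol (ψ + ((2 * Real.pi : ℂ)⁻¹) • ∂_{(1 : ℝ)} ψ) = ψ := by
  rw [SchwartzMap.fourierMultiplierCLM_apply]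
  have h : SchwartzMap.smulLeftCLM ℂ resSymbol (𝓕 (ψ + ((2 * Real.pi : ℂ)⁻¹) • ∂_{(1 : ℝ)} ψ)) =
      𝓕 ψ := by
    ext ξ
    rw [SchwartzMap.smulLeftCLM_apply_apply hasTemperateGrowth_resSymbol, fourier_add_deriv,
      smul_eq_mul, resSymbol_apply, inv_mul_cancel_left₀ (one_add_mul_I_ne_zero ξ)]
  rw [h, FourierTransform.fourierInv_fourier_eq]

theorem add_deriv_fourierMultiplier_resSymbol (f : 𝓢(ℝ, ℂ)) :
    SchwartzMap.fourierMultiplierCLM ℂ resSymbol f + ((2 * Real.pi : ℂ)⁻¹) •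
      ∂_{(1 : ℝ)} (SchwartzMap.fourierMultiplierCLM ℂ resSymbol f) = f := by
  refine (FourierTransform.fourierEquiv ℂ 𝓢(ℝ, ℂ)).injective ?_
  change 𝓕 (_ : 𝓢(ℝ, ℂ)) = 𝓕 f
  ext ξ
  rw [fourier_add_deriv, SchwartzMap.fourierMultiplierCLM_apply,
    FourierTransform.fourier_fourierInv_eq,
    SchwartzMap.smulLeftCLM_apply_apply hasTemperateGrowth_resSymbol, smul_eq_mul, resSymbol_apply,
    mul_inv_cancel_left₀ (one_add_mul_I_ne_zero ξ)]

theorem lineDeriv_cutoff_mul (φ : 𝓢(ℝ, ℂ)) :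
    ∂_{(1 : ℝ)} (SchwartzMap.smulLeftCLM ℂ cutoff φ) =
      SchwartzMap.smulLeftCLM ℂ cutoffDeriv φ + SchwartzMap.smulLeftCLM ℂ cutoff (∂_{(1 : ℝ)} φ) := by
  ext x
  rw [add_apply, SchwartzMap.smulLeftCLM_apply_apply hasTemperateGrowth_cutoff,
    SchwartzMap.smulLeftCLM_apply_apply cutoffDeriv.hasTemperateGrowth,
    SchwartzMap.lineDerivOp_apply_eq_fderiv, SchwartzMap.lineDerivOp_apply_eq_fderiv,
    fderiv_apply_one_eq_deriv, fderiv_apply_one_eq_deriv, cutoffDeriv_apply]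
  have h : (SchwartzMap.smulLeftCLM ℂ cutoff φ : ℝ → ℂ) = fun y => cutoff y * φ y := by
    ext y
    rw [SchwartzMap.smulLeftCLM_apply_apply hasTemperateGrowth_cutoff, smul_eq_mul]
  rw [h]
  exact deriv_fun_mul (contDiff_cutoff.differentiable (by simp) x) φ.differentiableAt

/-- The resolvent identity `[χ, P⁻¹] = P⁻¹ [P, χ] P⁻¹` for `P = 1 + ∂ₓ/(2π)`, where `[P, χ] =
χ'/(2π)`. Since `χ'` has compact support and `P⁻¹` has a decaying symbol, the right-hand side is
approximable. -/
theorem cutoff_commutator_resSymbol :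
    mulOp cutoff * fmul resSymbol - fmul resSymbol * mulOp cutoff =
      ((2 * Real.pi : ℂ)⁻¹) •
        (fmul resSymbol * mulOp cutoffDeriv.toBoundedContinuousFunction * fmul resSymbol) := by
  refine ext_on_schwartz fun f => ?_
  set φ := SchwartzMap.fourierMultiplierCLM ℂ resSymbol f with hφ
  have h1 := fourierMultiplier_resSymbol_add_deriv (SchwartzMap.smulLeftCLM ℂ cutoff φ)
  have h2 : SchwartzMap.smulLeftCLM ℂ cutoff φ + ((2 * Real.pi : ℂ)⁻¹) •
      ∂_{(1 : ℝ)} (SchwartzMap.smulLeftCLM ℂ cutoff φ) =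
      SchwartzMap.smulLeftCLM ℂ cutoff f +
        ((2 * Real.pi : ℂ)⁻¹) • SchwartzMap.smulLeftCLM ℂ cutoffDeriv φ := by
    conv_rhs => rw [← add_deriv_fourierMultiplier_resSymbol f, ← hφ]
    rw [lineDeriv_cutoff_mul, map_add, map_smul, smul_add]
    abel
  rw [h2, map_add, map_smul] at h1
  have e1 : (mulOp cutoff * fmul resSymbol) (f.toLp 2) =
      (SchwartzMap.smulLeftCLM ℂ cutoff φ).toLp 2 := by
    rw [mul_apply_eq_comp, fmul_toLp _ hasTemperateGrowth_resSymbol,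
      mulOp_toLp _ hasTemperateGrowth_cutoff]
  have e2 : (fmul resSymbol * mulOp cutoff) (f.toLp 2) =
      (SchwartzMap.fourierMultiplierCLM ℂ resSymbol (SchwartzMap.smulLeftCLM ℂ cutoff f)).toLp 2 := by
    rw [mul_apply_eq_comp, mulOp_toLp _ hasTemperateGrowth_cutoff,
      fmul_toLp _ hasTemperateGrowth_resSymbol]
  have e3 : (fmul resSymbol * mulOp cutoffDeriv.toBoundedContinuousFunction * fmul resSymbol)
      (f.toLp 2) = (SchwartzMap.fourierMultiplierCLM ℂ resSymbol
        (SchwartzMap.smulLeftCLM ℂ cutoffDeriv φ)).toLp 2 := by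
    rw [mul_apply_eq_comp, fmul_toLp _ hasTemperateGrowth_resSymbol, mul_apply_eq_comp,
      mulOp_toLp _ cutoffDeriv.hasTemperateGrowth, fmul_toLp _ hasTemperateGrowth_resSymbol]
    rfl
  rw [sub_apply, smul_apply, e1, e2, e3, sub_eq_iff_eq_add, ← h1]
  simp only [← SchwartzMap.toLpCLM_apply (𝕜 := ℂ), map_add, map_smul]
  abel

theorem cutoff_commutator_resSymbol_mem :
    mulOp cutoff * fmul resSymbol - fmul resSymbol * mulOp cutoff ∈ approximable L2 := by
  rw [cutoff_commutator_resSymbol, mul_assoc]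
  refine Submodule.smul_mem _ _ (mul_mem_approximable_left _ (mulOp_mul_fmul_mem _ _ ?_
    tendsto_resSymbol))
  exact hasCompactSupport_deriv_cutoff.is_zero_at_infty

/-- The symbols `m` for which `m(D)` commutes with the cutoff function up to an approximable
operator. -/
def cutoffCommutant : Subalgebra ℂ (ℝ →ᵇ ℂ) where
  carrier := {m | mulOp cutoff * fmul m - fmul m * mulOp cutoff ∈ approximable L2}
  mul_mem' := by
    intro m m' (hm : _ ∈ _) (hm' : _ ∈ _)
    change mulOp cutoff * fmul (m * m') - fmul (m * m') * mulOp cutoff ∈ approximable L2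
    have e : mulOp cutoff * fmul (m * m') - fmul (m * m') * mulOp cutoff =
        (mulOp cutoff * fmul m - fmul m * mulOp cutoff) * fmul m' +
          fmul m * (mulOp cutoff * fmul m' - fmul m' * mulOp cutoff) := by
      rw [map_mul]
      noncomm_ring
    rw [e]
    exact Submodule.add_mem _ (mul_mem_approximable_right _ hm) (mul_mem_approximable_left _ hm')
  add_mem' := by
    intro m m' (hm : _ ∈ _) (hm' : _ ∈ _)
    change mulOp cutoff * fmul (m + m') - fmul (m + m') * mulOp cutoff ∈ approximable L2
    have e : mulOp cutoff * fmul (m + m') - fmul (m + m') * mulOp cutoff =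
        (mulOp cutoff * fmul m - fmul m * mulOp cutoff) +
          (mulOp cutoff * fmul m' - fmul m' * mulOp cutoff) := by
      rw [map_add]
      noncomm_ring
    rw [e]
    exact Submodule.add_mem _ hm hm'
  algebraMap_mem' := by
    intro c
    change mulOp cutoff * fmul (algebraMap ℂ _ c) - fmul (algebraMap ℂ _ c) * mulOp cutoff ∈
      approximable L2
    rw [AlgHom.commutes, Algebra.commutes, sub_self]
    exact Submodule.zero_mem _

theorem mem_cutoffCommutant {m : ℝ →ᵇ ℂ} : m ∈ cutoffCommutant ↔
    mulOp cutoff * fmul m - fmul m * mulOp cutoff ∈ approximable L2 := Iff.rfl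

theorem resSymbol_mem_cutoffCommutant : resSymbol ∈ cutoffCommutant :=
  cutoff_commutator_resSymbol_mem

/-- `[χ, m⁻¹] = -m⁻¹ [χ, m] m⁻¹`. Closure under inversion is what admits quotients of polynomial
symbols. -/
theorem mem_cutoffCommutant_of_mul_eq_one {m m' : ℝ →ᵇ ℂ} (h : m * m' = 1)
    (hm : m ∈ cutoffCommutant) : m' ∈ cutoffCommutant := by
  rw [mem_cutoffCommutant] at hm ⊢
  have h1 : fmul m * fmul m' = 1 := by rw [← map_mul, h, map_one]
  have h2 : fmul m' * fmul m = 1 := by rw [← map_mul, mul_comm, h, map_one]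
  have e : mulOp cutoff * fmul m' - fmul m' * mulOp cutoff =
      -(fmul m' * ((mulOp cutoff * fmul m - fmul m * mulOp cutoff) * fmul m')) := by
    have : fmul m' * ((mulOp cutoff * fmul m - fmul m * mulOp cutoff) * fmul m') =
        fmul m' * mulOp cutoff * (fmul m * fmul m') -
          (fmul m' * fmul m) * mulOp cutoff * fmul m' := by noncomm_ring
    rw [this, h1, h2]
    simp
  rw [e]
  exact Submodule.neg_mem _ (mul_mem_approximable_left _ (mul_mem_approximable_right _ hm))

end Commutator

/-! ### Gluing of Fourier multipliers -/

section Gluing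

open scoped BoundedContinuousFunction

/-- The operator `(1 - χ) + χ m(D)`, where `χ` is the cutoff function. -/
def gluing (m : ℝ →ᵇ ℂ) : L2 →L[ℂ] L2 := 1 + mulOp cutoff * fmul (m - 1)

theorem tendsto_cutoff_mul_one_sub :
    Tendsto (cutoff * (1 - cutoff) : ℝ →ᵇ ℂ) (cocompact ℝ) (𝓝 0) := by
  have h : HasCompactSupport (cutoff * (1 - cutoff) : ℝ →ᵇ ℂ) := by
    refine HasCompactSupport.intro (isCompact_Icc (a := (0 : ℝ)) (b := 1)) fun x hx => ?_
    rw [Set.mem_Icc, not_and_or, not_le, not_le] at hx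
    change cutoff x * (1 - cutoff x) = 0
    rcases hx with hx | hx
    · rw [cutoff_of_nonpos hx.le, zero_mul]
    · rw [cutoff_of_one_le hx.le, sub_self, mul_zero]
  exact h.is_zero_at_infty

/-- Two errors arise in the product: the commutator of `χ` with `m - 1`, and the failure of `χ² =
χ`. The latter is confined to `[0, 1]` and is followed by the decaying symbol `m - 1`. -/
theorem gluing_mul_sub_mem {m m' : ℝ →ᵇ ℂ} (hm : m ∈ cutoffCommutant)
    (h1 : Tendsto (m - 1 : ℝ →ᵇ ℂ) (cocompact ℝ) (𝓝 0)) :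
    gluing (m * m') - gluing m * gluing m' ∈ approximable L2 := by
  have hc : m - 1 ∈ cutoffCommutant := cutoffCommutant.sub_mem hm cutoffCommutant.one_mem
  have hmul : m * m' - 1 = (m - 1) * (m' - 1) + (m - 1) + (m' - 1) := by ring
  have e : gluing (m * m') - gluing m * gluing m' =
      mulOp cutoff * ((mulOp cutoff * fmul (m - 1) - fmul (m - 1) * mulOp cutoff) *
        fmul (m' - 1)) +
      mulOp (cutoff * (1 - cutoff)) * fmul (m - 1) * fmul (m' - 1) := by
    rw [gluing, gluing, gluing, hmul]
    simp only [map_add, map_mul, map_sub, map_one]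
    noncomm_ring
  rw [e]
  refine Submodule.add_mem _
    (mul_mem_approximable_left _ (mul_mem_approximable_right _ (mem_cutoffCommutant.mp hc)))
    (mul_mem_approximable_right _ (mulOp_mul_fmul_mem _ _ tendsto_cutoff_mul_one_sub h1))

/-- Neumann series: `χ` acts with norm at most one. -/
theorem isUnit_gluing {m : ℝ →ᵇ ℂ} (hm : ‖m - 1‖ < 1) : IsUnit (gluing m) := by
  have h : gluing m = 1 - -(mulOp cutoff * fmul (m - 1)) := by rw [gluing, sub_neg_eq_add]
  rw [h]
  refine isUnit_one_sub_of_norm_lt_one ?_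
  rw [norm_neg]
  refine lt_of_le_of_lt (norm_mul_le _ _) (lt_of_le_of_lt ?_ hm)
  calc ‖mulOp cutoff‖ * ‖fmul (m - 1)‖ ≤ 1 * ‖m - 1‖ :=
        mul_le_mul ((norm_mulOp_le _).trans norm_cutoff_le) (norm_fmul_le _) (norm_nonneg _)
          zero_le_one
    _ = ‖m - 1‖ := one_mul _

/-- A bounded continuous function that is bounded away from zero has an inverse. -/
theorem exists_mul_eq_one {f : ℝ →ᵇ ℂ} {δ : ℝ} (hδ : 0 < δ) (hf : ∀ x, δ ≤ ‖f x‖) :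
    ∃ g : ℝ →ᵇ ℂ, f * g = 1 ∧ ‖g‖ ≤ δ⁻¹ := by
  have hne : ∀ x, f x ≠ 0 := fun x h => by
    have := hf x
    rw [h, norm_zero] at this
    linarith
  have hb : ∀ x, ‖(f x)⁻¹‖ ≤ δ⁻¹ := fun x => by
    rw [norm_inv]
    gcongr
    exact hf x
  refine ⟨BoundedContinuousFunction.ofNormedAddCommGroup (fun x => (f x)⁻¹)
    (f.continuous.inv₀ hne) δ⁻¹ hb, ?_, ?_⟩
  · ext x
    exact mul_inv_cancel₀ (hne x)
  · exact BoundedContinuousFunction.norm_ofNormedAddCommGroup_le _ (by positivity) _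

/-- A nonvanishing continuous function with a nonzero limit at infinity is bounded away from
zero. -/
theorem exists_pos_le_norm {f : ℝ →ᵇ ℂ} {l : ℂ} (hl : l ≠ 0) (hf : ∀ x, f x ≠ 0)
    (h : Tendsto f (cocompact ℝ) (𝓝 l)) : ∃ δ > 0, ∀ x, δ ≤ ‖f x‖ := by
  have h1 : ∀ᶠ x in cocompact ℝ, ‖l‖ / 2 < ‖f x‖ :=
    h.norm.eventually_const_lt (half_lt_self (norm_pos_iff.mpr hl))
  obtain ⟨K, hK, hKs⟩ := mem_cocompact.mp h1
  obtain ⟨δ, hδ, hδK⟩ : ∃ δ > 0, ∀ x ∈ K, δ ≤ ‖f x‖ :=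
    hK.exists_forall_le' (f := fun x => ‖f x‖) (a := 0) f.continuous.norm.continuousOn
      fun x _ => norm_pos_iff.mpr (hf x)
  refine ⟨min δ (‖l‖ / 2), lt_min hδ (half_pos (norm_pos_iff.mpr hl)), fun x => ?_⟩
  by_cases hx : x ∈ K
  · exact (min_le_left _ _).trans (hδK x hx)
  · exact (min_le_right _ _).trans (le_of_lt (hKs hx))

/-- The slit plane is star-shaped about `1`, so the segment from `1` to `z` misses the origin. -/
theorem one_add_mul_ne_zero_of_mem_slitPlane {z : ℂ} (hz : z ∈ Complex.slitPlane) {t : ℝ}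
    (ht0 : 0 ≤ t) (ht1 : t ≤ 1) : 1 + (t : ℂ) * (z - 1) ≠ 0 := by
  intro h
  have hre := congrArg Complex.re h
  have him := congrArg Complex.im h
  simp at hre him
  rcases him with rfl | him
  · simp at hre
  · rcases Complex.mem_slitPlane_iff.mp hz with h1 | h1
    · rcases ht0.eq_or_lt with rfl | ht
      · simp at hre
      · nlinarith [mul_pos ht h1]
    · exact h1 him

/-- Off a compact set `K` the values of `m` are within `1/2` of `1`, and so is the whole segment; on
`[0, 1] × K` a minimum is attained. -/
theorem exists_pos_le_norm_segment {m : ℝ →ᵇ ℂ}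
    (h1 : Tendsto (m - 1 : ℝ →ᵇ ℂ) (cocompact ℝ) (𝓝 0)) (hs : ∀ x, m x ∈ Complex.slitPlane) :
    ∃ δ > 0, ∀ t : ℝ, 0 ≤ t → t ≤ 1 → ∀ x, δ ≤ ‖1 + (t : ℂ) * (m x - 1)‖ := by
  have h2 : ∀ᶠ x in cocompact ℝ, ‖m x - 1‖ < 1 / 2 := by
    have := h1.norm
    rw [norm_zero] at this
    exact this.eventually_lt_const (by norm_num)
  obtain ⟨K, hK, hKs⟩ := mem_cocompact.mp h2
  obtain ⟨δ, hδ, hδK⟩ : ∃ δ > 0, ∀ p ∈ Set.Icc (0 : ℝ) 1 ×ˢ K,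
      δ ≤ ‖1 + (p.1 : ℂ) * (m p.2 - 1)‖ := by
    refine (isCompact_Icc.prod hK).exists_forall_le'
      (f := fun p : ℝ × ℝ => ‖1 + (p.1 : ℂ) * (m p.2 - 1)‖) (a := 0) ?_ fun p hp =>
        norm_pos_iff.mpr (one_add_mul_ne_zero_of_mem_slitPlane (hs p.2) hp.1.1 hp.1.2)
    have := m.continuous
    fun_prop
  refine ⟨min δ (1 / 2), lt_min hδ (by norm_num), fun t ht0 ht1 x => ?_⟩
  by_cases hx : x ∈ K
  · exact (min_le_left _ _).trans (hδK (t, x) ⟨⟨ht0, ht1⟩, hx⟩)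
  · refine (min_le_right _ _).trans ?_
    have h3 : ‖m x - 1‖ < 1 / 2 := hKs hx
    have h4 : ‖(t : ℂ) * (m x - 1)‖ ≤ 1 / 2 := by
      rw [norm_mul, Complex.norm_real, Real.norm_of_nonneg ht0]
      nlinarith [norm_nonneg (m x - 1)]
    have h5 := norm_sub_norm_le (1 : ℂ) (-((t : ℂ) * (m x - 1)))
    rw [norm_one, norm_neg, sub_neg_eq_add] at h5
    linarith

/-- The gluing of a symbol with values in the slit plane is almost invertible: deform the symbol to
`1` along straight lines. -/
theorem almostUnit_gluing {m : ℝ →ᵇ ℂ} (hm : m ∈ cutoffCommutant)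
    (h1 : Tendsto (m - 1 : ℝ →ᵇ ℂ) (cocompact ℝ) (𝓝 0)) (hs : ∀ x, m x ∈ Complex.slitPlane) :
    AlmostUnit (gluing m) := by
  obtain ⟨δ, hδ, hseg⟩ := exists_pos_le_norm_segment h1 hs
  -- Consecutive symbols of the path have quotient `1 + (m - 1) / (N p_j)`. As `‖p_j⁻¹‖ ≤ δ⁻¹`, this
  -- choice of `N` puts it within distance less than `1` of `1`.
  obtain ⟨N, hN⟩ := exists_nat_gt (‖m - 1‖ * δ⁻¹)
  have hN0 : (0 : ℝ) < N := lt_of_le_of_lt (by positivity) hN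
  have hNC : (N : ℂ) ≠ 0 := by
    have : N ≠ 0 := by exact_mod_cast hN0.ne'
    exact_mod_cast this
  let p : ℕ → (ℝ →ᵇ ℂ) := fun j => 1 + ((j : ℂ) / N) • (m - 1)
  have hp : ∀ j, p j - 1 = ((j : ℂ) / N) • (m - 1) := fun j => add_sub_cancel_left _ _
  have key : ∀ j ≤ N, AlmostUnit (gluing (p j)) := by
    intro j
    induction j with
    | zero =>
      intro _
      refine AlmostUnit.of_isUnit (isUnit_gluing ?_)
      rw [hp]
      simp
    | succ j ih =>
      intro hj
      obtain ⟨g, hg, hgn⟩ := exists_mul_eq_one (f := p j) hδ fun x => by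
        have := hseg ((j : ℝ) / N) (by positivity) (by
          rw [div_le_one hN0]; exact_mod_cast (Nat.le_of_succ_le hj)) x
        push_cast at this
        exact this
      set k : ℝ →ᵇ ℂ := 1 + ((1 : ℂ) / N) • ((m - 1) * g) with hk
      have hpk : p (j + 1) = p j * k := by
        have : p j * k = p j + ((1 : ℂ) / N) • ((m - 1) * (p j * g)) := by
          rw [hk, mul_add, mul_one, mul_smul_comm]
          congr 2
          ring
        rw [this, hg, mul_one]
        simp only [p]
        rw [add_assoc, ← add_smul]
        congr 2
        push_cast
        ring
      have hku : IsUnit (gluing k) := by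
        refine isUnit_gluing ?_
        rw [hk, add_sub_cancel_left, norm_smul, norm_div, norm_one, Complex.norm_natCast,
          one_div, inv_mul_lt_iff₀ hN0, mul_one]
        refine lt_of_le_of_lt (norm_mul_le _ _) (lt_of_le_of_lt ?_ hN)
        gcongr
      rw [hpk]
      refine ((ih (Nat.le_of_succ_le hj)).mul (AlmostUnit.of_isUnit hku)).congr
        (gluing_mul_sub_mem ?_ ?_)
      · exact cutoffCommutant.add_mem cutoffCommutant.one_mem
          (cutoffCommutant.smul_mem (cutoffCommutant.sub_mem hm cutoffCommutant.one_mem) _)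
      · rw [hp]
        have := h1.const_mul ((j : ℂ) / N)
        rw [mul_zero] at this
        exact this
  have := key N le_rfl
  have hpN : p N = m := by
    simp only [p]
    rw [div_self hNC, one_smul, add_sub_cancel]
  rwa [hpN] at this

end Gluing

/-! ### Differential operators as bounded operators on `L²` -/

section Realization

open scoped BoundedContinuousFunction

/-- The Fourier variable `2 π i ξ` that corresponds to `∂ₓ`. -/
def freq (ξ : ℝ) : ℂ := 2 * Real.pi * Complex.I * ξ

theorem hasTemperateGrowth_freq_pow (k : ℕ) : Function.HasTemperateGrowth fun ξ => freq ξ ^ k := by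
  unfold freq
  fun_prop

/-- The symbol `(2 π i ξ)ᵏ (1 + i ξ)⁻ⁿ` (for `k ≤ n`). -/
def derivSymbol (n k : ℕ) : ℝ →ᵇ ℂ :=
  ((2 * Real.pi : ℂ) ^ k) • ((1 - resSymbol) ^ k * resSymbol ^ (n - k))

/-- Rests on `1 - (1 + iξ)⁻¹ = iξ (1 + iξ)⁻¹`. Writing the symbol as a polynomial in `resSymbol`
makes its boundedness and its membership in `cutoffCommutant` automatic; `k ≤ n` is needed because
`n - k` is truncated. -/
theorem derivSymbol_apply {n k : ℕ} (hk : k ≤ n) (ξ : ℝ) :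
    derivSymbol n k ξ = freq ξ ^ k * resSymbol ξ ^ n := by
  have h : 1 - resSymbol ξ = ξ * Complex.I * resSymbol ξ := by
    rw [resSymbol_apply]
    field_simp [one_add_mul_I_ne_zero ξ]
    ring
  change (2 * Real.pi : ℂ) ^ k * ((1 - resSymbol ξ) ^ k * resSymbol ξ ^ (n - k)) = _
  rw [h, freq]
  conv_rhs => rw [← Nat.add_sub_cancel' hk, pow_add]
  ring

theorem derivSymbol_zero (n : ℕ) : derivSymbol n 0 = resSymbol ^ n := by
  simp [derivSymbol]

theorem hasTemperateGrowth_resSymbol_pow (n : ℕ) :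
    Function.HasTemperateGrowth (resSymbol ^ n : ℝ →ᵇ ℂ) :=
  hasTemperateGrowth_resSymbol.pow n

theorem coe_derivSymbol {n k : ℕ} (hk : k ≤ n) :
    (derivSymbol n k : ℝ → ℂ) = (resSymbol ^ n : ℝ →ᵇ ℂ) * fun ξ => freq ξ ^ k := by
  ext ξ
  rw [derivSymbol_apply hk, mul_comm]
  rfl

theorem hasTemperateGrowth_derivSymbol {n k : ℕ} (hk : k ≤ n) :
    Function.HasTemperateGrowth (derivSymbol n k) := by
  rw [coe_derivSymbol hk]
  exact (hasTemperateGrowth_resSymbol_pow n).mul (hasTemperateGrowth_freq_pow k)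

theorem derivSymbol_mem_cutoffCommutant (n k : ℕ) : derivSymbol n k ∈ cutoffCommutant :=
  cutoffCommutant.smul_mem (cutoffCommutant.mul_mem
    (cutoffCommutant.pow_mem
      (cutoffCommutant.sub_mem cutoffCommutant.one_mem resSymbol_mem_cutoffCommutant) _)
    (cutoffCommutant.pow_mem resSymbol_mem_cutoffCommutant _)) _

theorem tendsto_derivSymbol_self (n : ℕ) :
    Tendsto (derivSymbol n n) (cocompact ℝ) (𝓝 ((2 * Real.pi : ℂ) ^ n)) := by
  have h := (((tendsto_const_nhds (x := (1 : ℂ))).sub tendsto_resSymbol).pow n).const_mul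
    ((2 * Real.pi : ℂ) ^ n)
  rw [sub_zero, one_pow, mul_one] at h
  refine h.congr fun ξ => ?_
  change _ = (2 * Real.pi : ℂ) ^ n * ((1 - resSymbol ξ) ^ n * resSymbol ξ ^ (n - n))
  rw [Nat.sub_self, pow_zero, mul_one]

theorem tendsto_derivSymbol_of_lt {n k : ℕ} (hk : k < n) :
    Tendsto (derivSymbol n k) (cocompact ℝ) (𝓝 0) := by
  have h := ((((tendsto_const_nhds (x := (1 : ℂ))).sub tendsto_resSymbol).pow k).mul
    (tendsto_resSymbol.pow (n - k))).const_mul ((2 * Real.pi : ℂ) ^ k)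
  rw [zero_pow (Nat.sub_ne_zero_of_lt hk), mul_zero, mul_zero] at h
  exact h

theorem distDeriv_eq_fourierMultiplier (k : ℕ) (u : L2) :
    distDeriv k u =
      TemperedDistribution.fourierMultiplierCLM ℂ (fun ξ => freq ξ ^ k) (u : 𝓢'(ℝ, ℂ)) := by
  induction k with
  | zero =>
    simp [distDeriv]
  | succ k ih =>
    have e2 : distDeriv (k + 1) u = ∂_{(1 : ℝ)} (distDeriv k u) := by
      rw [distDeriv, LineDeriv.iteratedLineDerivOp_succ_left]
      rfl
    rw [e2, ih, TemperedDistribution.lineDeriv_eq_fourierMultiplierCLM,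
      TemperedDistribution.fourierMultiplierCLM_fourierMultiplierCLM_apply
        (hasTemperateGrowth_freq_pow k) (by fun_prop)]
    rw [← smul_apply, ← TemperedDistribution.fourierMultiplierCLM_smul
      ((hasTemperateGrowth_freq_pow k).mul (by fun_prop))]
    congr 2
    ext ξ
    simp [freq, pow_succ]
    ring

theorem rpow_eq_norm_pow (n : ℕ) (x : ℝ) :
    (1 + ‖x‖ ^ 2) ^ ((n : ℝ) / 2) = ‖1 + (x : ℂ) * Complex.I‖ ^ n := by
  rw [← norm_one_add_mul_I_sq, ← Real.rpow_natCast, ← Real.rpow_mul (norm_nonneg _),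
    ← Real.rpow_natCast]
  congr 1
  push_cast
  ring

/-- The Bessel potential of order `n` has symbol `(1 + ξ²)^(n/2) = |1 + iξ|ⁿ`, so its product with
`(1 + iξ)⁻ⁿ` has modulus one. -/
theorem fmul_resSymbol_pow_mem_sobolev (n : ℕ) (f : L2) : fmul (resSymbol ^ n) f ∈ sobolev n := by
  change TemperedDistribution.MemSobolev (n : ℝ) 2 (fmul (resSymbol ^ n) f : 𝓢'(ℝ, ℂ))
  rw [fmul_toDistribution _ (hasTemperateGrowth_resSymbol_pow n), ← add_zero (n : ℝ),
    ← TemperedDistribution.memSobolev_besselPotential_iff, TemperedDistribution.besselPotential,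
    TemperedDistribution.fourierMultiplierCLM_fourierMultiplierCLM_apply
      (hasTemperateGrowth_resSymbol_pow n) (by fun_prop)]
  refine TemperedDistribution.MemSobolev.fourierMultiplierCLM_of_bounded
    (TemperedDistribution.memSobolev_zero_iff.mpr ⟨f, rfl⟩)
    ((hasTemperateGrowth_resSymbol_pow n).mul (by fun_prop)) ⟨1, fun x => ?_⟩
  change ‖resSymbol x ^ n * (((1 + ‖x‖ ^ 2) ^ ((n : ℝ) / 2) : ℝ) : ℂ)‖ ≤ 1
  rw [rpow_eq_norm_pow, norm_mul, norm_pow, resSymbol_apply, norm_inv, Complex.norm_real, norm_pow,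
    norm_norm, ← mul_pow, inv_mul_cancel₀ (norm_ne_zero_iff.mpr (one_add_mul_I_ne_zero x)), one_pow]

theorem weakDeriv_fmul_resSymbol_pow {n k : ℕ} (hk : k ≤ n) (f : L2) :
    weakDeriv k (fmul (resSymbol ^ n) f) = fmul (derivSymbol n k) f := by
  refine coe_injective ?_
  rw [weakDeriv_spec (fmul_resSymbol_pow_mem_sobolev n f) hk, distDeriv_eq_fourierMultiplier,
    fmul_toDistribution _ (hasTemperateGrowth_resSymbol_pow n),
    TemperedDistribution.fourierMultiplierCLM_fourierMultiplierCLM_apply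
      (hasTemperateGrowth_resSymbol_pow n) (hasTemperateGrowth_freq_pow k), ← coe_derivSymbol hk,
    fmul_toDistribution _ (hasTemperateGrowth_derivSymbol hk)]

/-- The preimage is `(1 + iξ)ⁿ` applied to `u`, computed as the Bessel potential followed by the
unimodular multiplier `(1 + iξ)ⁿ (1 + ξ²)^(-n/2)`, so that it stays in `L²`. -/
theorem exists_fmul_resSymbol_pow_eq {n : ℕ} {u : L2} (hu : u ∈ sobolev n) :
    ∃ f : L2, fmul (resSymbol ^ n) f = u := by
  have hu' : TemperedDistribution.MemSobolev (n : ℝ) 2 (u : 𝓢'(ℝ, ℂ)) := hu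
  have hg : Function.HasTemperateGrowth fun ξ : ℝ => (1 + (ξ : ℂ) * Complex.I) ^ n *
      ((((1 + ‖ξ‖ ^ 2) ^ (-((n : ℝ) / 2)) : ℝ)) : ℂ) := by fun_prop
  have hb : Function.HasTemperateGrowth fun ξ : ℝ =>
      ((((1 + ‖ξ‖ ^ 2) ^ ((n : ℝ) / 2) : ℝ)) : ℂ) := by fun_prop
  have hp : ∀ ξ : ℝ, (0 : ℝ) < 1 + ‖ξ‖ ^ 2 := fun ξ => by positivity
  rw [← add_zero (n : ℝ), ← TemperedDistribution.memSobolev_besselPotential_iff] at hu'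
  have h1 := hu'.fourierMultiplierCLM_of_bounded hg ⟨1, fun ξ => by
    rw [Real.rpow_neg (hp ξ).le, rpow_eq_norm_pow, norm_mul, norm_pow, Complex.norm_real,
      norm_inv, norm_pow, norm_norm, mul_inv_cancel₀ (pow_ne_zero _
        (norm_ne_zero_iff.mpr (one_add_mul_I_ne_zero ξ)))]⟩
  obtain ⟨f, hf⟩ := TemperedDistribution.memSobolev_zero_iff.mp h1
  refine ⟨f, coe_injective ?_⟩
  rw [fmul_toDistribution _ (hasTemperateGrowth_resSymbol_pow n), ← hf,
    TemperedDistribution.besselPotential,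
    TemperedDistribution.fourierMultiplierCLM_fourierMultiplierCLM_apply hb hg,
    TemperedDistribution.fourierMultiplierCLM_fourierMultiplierCLM_apply (hb.mul hg)
      (hasTemperateGrowth_resSymbol_pow n)]
  have e : (fun ξ : ℝ => ((((1 + ‖ξ‖ ^ 2) ^ ((n : ℝ) / 2) : ℝ)) : ℂ)) *
      (fun ξ : ℝ => (1 + (ξ : ℂ) * Complex.I) ^ n *
        ((((1 + ‖ξ‖ ^ 2) ^ (-((n : ℝ) / 2)) : ℝ)) : ℂ)) * ⇑(resSymbol ^ n : ℝ →ᵇ ℂ) =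
      fun _ => 1 := by
    ext ξ
    change ((((1 + ‖ξ‖ ^ 2) ^ ((n : ℝ) / 2) : ℝ)) : ℂ) * ((1 + (ξ : ℂ) * Complex.I) ^ n *
        ((((1 + ‖ξ‖ ^ 2) ^ (-((n : ℝ) / 2)) : ℝ)) : ℂ)) * resSymbol ξ ^ n = 1
    rw [Real.rpow_neg (hp ξ).le, Complex.ofReal_inv, resSymbol_apply, inv_pow]
    have h2 : ((((1 + ‖ξ‖ ^ 2) ^ ((n : ℝ) / 2) : ℝ)) : ℂ) ≠ 0 :=
      Complex.ofReal_ne_zero.mpr (Real.rpow_pos_of_pos (hp ξ) _).ne'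
    have h3 : (1 + (ξ : ℂ) * Complex.I) ^ n ≠ 0 := pow_ne_zero _ (one_add_mul_I_ne_zero ξ)
    field_simp
  rw [e]
  simp

theorem mulOp_injective {φ : ℝ →ᵇ ℂ} (hφ : ∀ x, φ x ≠ 0) : Function.Injective (mulOp φ) := by
  refine (injective_iff_map_eq_zero _).mpr fun f hf => ?_
  refine Lp.ext ?_
  have h := mulOp_coeFn φ f
  rw [hf] at h
  filter_upwards [h, Lp.coeFn_zero ℂ 2 (volume : Measure ℝ)] with x h1 h2
  rw [h2] at h1 ⊢
  exact ((mul_eq_zero.mp h1.symm).resolve_left (hφ x))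

theorem fmul_injective {m : ℝ →ᵇ ℂ} (hm : ∀ x, m x ≠ 0) : Function.Injective (fmul m) := by
  intro f g h
  rw [fmul_apply, fmul_apply] at h
  exact (Lp.fourierTransformₗᵢ ℝ ℂ).injective
    (mulOp_injective hm ((Lp.fourierTransformₗᵢ ℝ ℂ).symm.injective h))

/-- The bounded operator `∑_{k ≤ n} A_k(x) ∂ₓᵏ (1 + ∂ₓ / (2 π))⁻ⁿ`. -/
def totalOp (n : ℕ) (A : ℕ → ℝ →ᵇ ℂ) : L2 →L[ℂ] L2 :=
  ∑ k ∈ Finset.range (n + 1), mulOp (A k) * fmul (derivSymbol n k)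

/-- The coefficients of `z - ∑_{k ≤ n} A_k(x) ∂ₓᵏ`. -/
def shiftCoeff (z : ℂ) (A : ℕ → ℝ →ᵇ ℂ) (k : ℕ) : ℝ →ᵇ ℂ :=
  (if k = 0 then algebraMap ℂ (ℝ →ᵇ ℂ) z else 0) - A k

theorem totalOp_shiftCoeff (n : ℕ) (z : ℂ) (A : ℕ → ℝ →ᵇ ℂ) :
    totalOp n (shiftCoeff z A) = z • fmul (resSymbol ^ n) - totalOp n A := by
  simp only [totalOp, shiftCoeff, map_sub, sub_mul, Finset.sum_sub_distrib]
  congr 1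
  rw [Finset.sum_eq_single_of_mem 0 (by simp)]
  · rw [if_pos rfl, AlgHom.commutes, derivSymbol_zero, ← Algebra.smul_def]
  · intro k _ hk
    rw [if_neg hk, map_zero, zero_mul]

variable {n : ℕ} {a : ℕ → ℝ → ℝ} {A : ℕ → ℝ →ᵇ ℂ}

theorem diffOp_domain_eq (hA : ∀ k ≤ n, ∀ x, A k x = a k x) : (diffOp n a).domain = sobolev n := by
  have hre : ∀ k ≤ n, ∀ x, a k x = (A k x).re := fun k hk x => by
    rw [hA k hk, Complex.ofReal_re]
  refine diffOp_domain n a (fun k hk => ?_) fun k hk => ⟨‖A k‖, fun x => ?_⟩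
  · have : a k = fun x => (A k x).re := funext (hre k hk)
    rw [this]
    exact (Complex.continuous_re.comp (A k).continuous).measurable
  · have := (A k).norm_coe_le_norm x
    rwa [hA k hk, Complex.norm_real, Real.norm_eq_abs] at this

theorem totalOp_coeFn (n : ℕ) (A : ℕ → ℝ →ᵇ ℂ) (f : L2) :
    totalOp n A f =ᵐ[volume]
      fun x => ∑ k ∈ Finset.range (n + 1), A k x * fmul (derivSymbol n k) f x := by
  have h : totalOp n A f =
      ∑ k ∈ Finset.range (n + 1), (1 : ℂ) • mulOp (A k) (fmul (derivSymbol n k) f) := by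
    rw [totalOp, sum_apply]
    simp only [one_smul]
    rfl
  rw [h]
  refine (L2.coeFn_sum_smul _ _ _ _ fun k => mulOp_coeFn (A k) (fmul (derivSymbol n k) f)).trans
    (Eventually.of_forall fun x => ?_)
  simp only [one_mul]

/-- The isomorphism of `L²` with the domain `Hⁿ` of a differential operator. -/
def domainEquiv (hA : ∀ k ≤ n, ∀ x, A k x = a k x) : L2 ≃ₗ[ℂ] (diffOp n a).domain :=
  LinearEquiv.ofBijective
    ((fmul (resSymbol ^ n) : L2 →ₗ[ℂ] L2).codRestrict (diffOp n a).domain fun f => by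
      rw [diffOp_domain_eq hA]
      exact fmul_resSymbol_pow_mem_sobolev n f)
    ⟨fun f g h => fmul_injective (m := resSymbol ^ n)
        (fun x => pow_ne_zero n (resSymbol_ne_zero x)) (congrArg Subtype.val h),
      fun u => by
        obtain ⟨f, hf⟩ := exists_fmul_resSymbol_pow_eq
          (u := u.1) (n := n) (by rw [← diffOp_domain_eq hA]; exact u.2)
        exact ⟨f, Subtype.ext hf⟩⟩

theorem coe_domainEquiv (hA : ∀ k ≤ n, ∀ x, A k x = a k x) (f : L2) :
    (domainEquiv hA f : L2) = fmul (resSymbol ^ n) f := rfl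

theorem diffOp_domainEquiv (hA : ∀ k ≤ n, ∀ x, A k x = a k x) (f : L2) :
    (diffOp n a).toFun (domainEquiv hA f) = totalOp n A f := by
  refine L2.ext_of_ae ((domainEquiv hA f).2.2.coeFn_toLp) (totalOp_coeFn n A f)
    (Eventually.of_forall fun x => ?_)
  refine Finset.sum_congr rfl fun k hk => ?_
  have hk' := Finset.mem_range_succ_iff.mp hk
  rw [coe_domainEquiv, weakDeriv_fmul_resSymbol_pow hk', hA k hk']

theorem shifted_diffOp_domainEquiv (hA : ∀ k ≤ n, ∀ x, A k x = a k x) (z : ℂ) (f : L2) :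
    shifted (diffOp n a) z (domainEquiv hA f) = totalOp n (shiftCoeff z A) f := by
  rw [totalOp_shiftCoeff]
  change z • (domainEquiv hA f : L2) - (diffOp n a).toFun (domainEquiv hA f) = _
  rw [diffOp_domainEquiv hA, coe_domainEquiv]
  rfl

theorem indexZero_shifted_diffOp (hA : ∀ k ≤ n, ∀ x, A k x = a k x) {z : ℂ}
    (h : AlmostUnit (totalOp n (shiftCoeff z A))) : IndexZero (shifted (diffOp n a) z) := by
  have h1 := h.indexZero.comp_equiv (domainEquiv hA).symm
  have e : shifted (diffOp n a) z =
      (totalOp n (shiftCoeff z A) : L2 →ₗ[ℂ] L2) ∘ₗ (domainEquiv hA).symm.toLinearMap := by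
    refine LinearMap.ext fun u => ?_
    obtain ⟨f, rfl⟩ := (domainEquiv hA).surjective u
    rw [shifted_diffOp_domainEquiv hA]
    simp
  rw [e]
  exact h1

theorem boundedlyInvertible_diffOp (hA : ∀ k ≤ n, ∀ x, A k x = a k x) {z : ℂ}
    (h : IsUnit (totalOp n (shiftCoeff z A))) : BoundedlyInvertible (diffOp n a) z := by
  obtain ⟨S, hS1, hS2⟩ := isUnit_iff_exists.mp h
  refine ⟨fmul (resSymbol ^ n) * S, fun f => ⟨(domainEquiv hA (S f)).2, ?_⟩, fun u => ?_⟩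
  · refine (shifted_diffOp_domainEquiv hA z (S f)).trans ?_
    exact DFunLike.congr_fun hS1 f
  · obtain ⟨f, rfl⟩ := (domainEquiv hA).surjective u
    rw [shifted_diffOp_domainEquiv hA, coe_domainEquiv]
    change fmul (resSymbol ^ n) ((S * totalOp n (shiftCoeff z A)) f) = _
    rw [hS2]
    rfl

end Realization

/-! ### Constant coefficients and asymptotically constant coefficients -/

section Asymptotics

open scoped BoundedContinuousFunction FourierTransform

/-- The polynomial `∑_{k ≤ n} c_k (2 π i ξ)ᵏ`. -/
def polySymbol (n : ℕ) (c : ℕ → ℂ) (ξ : ℝ) : ℂ := ∑ k ∈ Finset.range (n + 1), c k * freq ξ ^ k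

/-- The symbol `(1 + i ξ)⁻ⁿ ∑_{k ≤ n} c_k (2 π i ξ)ᵏ`. -/
def normSymbol (n : ℕ) (c : ℕ → ℂ) : ℝ →ᵇ ℂ := ∑ k ∈ Finset.range (n + 1), c k • derivSymbol n k

theorem normSymbol_apply (n : ℕ) (c : ℕ → ℂ) (ξ : ℝ) :
    normSymbol n c ξ = polySymbol n c ξ * resSymbol ξ ^ n := by
  rw [normSymbol, BoundedContinuousFunction.coe_sum, Finset.sum_apply, polySymbol, Finset.sum_mul]
  refine Finset.sum_congr rfl fun k hk => ?_
  change c k * derivSymbol n k ξ = _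
  rw [derivSymbol_apply (Finset.mem_range_succ_iff.mp hk), mul_assoc]

theorem normSymbol_mem_cutoffCommutant (n : ℕ) (c : ℕ → ℂ) : normSymbol n c ∈ cutoffCommutant :=
  cutoffCommutant.sum_mem fun k _ =>
    cutoffCommutant.smul_mem (derivSymbol_mem_cutoffCommutant n k) _

theorem tendsto_normSymbol (n : ℕ) (c : ℕ → ℂ) :
    Tendsto (normSymbol n c) (cocompact ℝ) (𝓝 (c n * (2 * Real.pi : ℂ) ^ n)) := by
  have h : Tendsto (fun ξ => ∑ k ∈ Finset.range n, c k * derivSymbol n k ξ + c n * derivSymbol n n ξ)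
      (cocompact ℝ) (𝓝 (∑ k ∈ Finset.range n, c k * 0 + c n * (2 * Real.pi : ℂ) ^ n)) := by
    refine Tendsto.add (tendsto_finsetSum _ fun k hk => ?_)
      ((tendsto_derivSymbol_self n).const_mul _)
    exact (tendsto_derivSymbol_of_lt (Finset.mem_range.mp hk)).const_mul _
  simp only [mul_zero, Finset.sum_const_zero, zero_add] at h
  refine h.congr fun ξ => ?_
  rw [normSymbol, BoundedContinuousFunction.coe_sum, Finset.sum_apply, Finset.sum_range_succ]
  rfl

/-- Ellipticity: the normalized symbol has the nonzero limit `c n (2π)ⁿ` at infinity, so having no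
zeros it is bounded away from zero. -/
theorem exists_normSymbol_mul_eq_one {n : ℕ} {c : ℕ → ℂ} (hc : c n ≠ 0)
    (h : ∀ ξ, polySymbol n c ξ ≠ 0) : ∃ g : ℝ →ᵇ ℂ, normSymbol n c * g = 1 := by
  have hpi : (2 * Real.pi : ℂ) ^ n ≠ 0 := pow_ne_zero _ (by
    simp [Real.pi_ne_zero])
  obtain ⟨δ, hδ, hle⟩ := exists_pos_le_norm (mul_ne_zero hc hpi) (f := normSymbol n c) (fun ξ => by
    rw [normSymbol_apply]
    exact mul_ne_zero (h ξ) (pow_ne_zero _ (resSymbol_ne_zero ξ))) (tendsto_normSymbol n c)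
  obtain ⟨g, hg, -⟩ := exists_mul_eq_one hδ hle
  exact ⟨g, hg⟩

theorem mul_apply_of_normSymbol_mul_eq_one {n : ℕ} {c c' : ℕ → ℂ} {g : ℝ →ᵇ ℂ}
    (hg : normSymbol n c * g = 1) (ξ : ℝ) :
    (normSymbol n c' * g) ξ = polySymbol n c' ξ / polySymbol n c ξ := by
  have h1 : normSymbol n c ξ * g ξ = 1 := DFunLike.congr_fun hg ξ
  change normSymbol n c' ξ * g ξ = _
  rw [normSymbol_apply] at h1 ⊢
  have h2 : polySymbol n c ξ ≠ 0 := fun h0 => by simp [h0] at h1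
  rw [eq_div_iff h2]
  linear_combination polySymbol n c' ξ * h1

theorem tendsto_normSymbol_mul_sub_one {n : ℕ} {c c' : ℕ → ℂ} (hc : c n ≠ 0) (hcc : c' n = c n)
    {g : ℝ →ᵇ ℂ} (hg : normSymbol n c * g = 1) :
    Tendsto (normSymbol n c' * g - 1 : ℝ →ᵇ ℂ) (cocompact ℝ) (𝓝 0) := by
  have hpi : (2 * Real.pi : ℂ) ^ n ≠ 0 := pow_ne_zero _ (by
    simp [Real.pi_ne_zero])
  have hL : c n * (2 * Real.pi : ℂ) ^ n ≠ 0 := mul_ne_zero hc hpi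
  have h := ((tendsto_normSymbol n c').mul ((tendsto_normSymbol n c).inv₀ hL)).sub_const 1
  rw [hcc, mul_inv_cancel₀ hL, sub_self] at h
  refine h.congr fun ξ => ?_
  have h1 : normSymbol n c ξ * g ξ = 1 := DFunLike.congr_fun hg ξ
  change _ = normSymbol n c' ξ * g ξ - 1
  rw [← eq_inv_of_mul_eq_one_right h1]

/-- The coefficients of `z - ∑_{k ≤ n} l_k ∂ₓᵏ`. -/
def shiftConst (z : ℂ) (l : ℕ → ℝ) (k : ℕ) : ℂ := (if k = 0 then z else 0) - l k

theorem polySymbol_shiftConst (n : ℕ) (z : ℂ) (l : ℕ → ℝ) (ξ : ℝ) :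
    polySymbol n (shiftConst z l) ξ = z - polySymbol n (fun k => l k) ξ := by
  simp only [polySymbol, shiftConst, sub_mul, Finset.sum_sub_distrib]
  congr 1
  rw [Finset.sum_eq_single_of_mem 0 (by simp)]
  · simp
  · intro k _ hk
    rw [if_neg hk, zero_mul]

/-- Real constants as bounded continuous functions. -/
def constCoeff (l : ℕ → ℝ) (k : ℕ) : ℝ →ᵇ ℂ := algebraMap ℂ (ℝ →ᵇ ℂ) (l k)

theorem shiftCoeff_constCoeff (z : ℂ) (l : ℕ → ℝ) (k : ℕ) :
    shiftCoeff z (constCoeff l) k = algebraMap ℂ (ℝ →ᵇ ℂ) (shiftConst z l k) := by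
  rw [shiftCoeff, constCoeff, shiftConst, map_sub, apply_ite (algebraMap ℂ (ℝ →ᵇ ℂ)), map_zero]

theorem totalOp_const (n : ℕ) (c : ℕ → ℂ) :
    totalOp n (fun k => algebraMap ℂ (ℝ →ᵇ ℂ) (c k)) = fmul (normSymbol n c) := by
  rw [totalOp, normSymbol, map_sum]
  refine Finset.sum_congr rfl fun k _ => ?_
  rw [AlgHom.commutes, map_smul, ← Algebra.smul_def]

theorem totalOp_shiftCoeff_constCoeff (n : ℕ) (z : ℂ) (l : ℕ → ℝ) :
    totalOp n (shiftCoeff z (constCoeff l)) = fmul (normSymbol n (shiftConst z l)) := by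
  rw [← totalOp_const]
  congr 1
  exact funext fun k => shiftCoeff_constCoeff z l k

theorem constCoeff_apply {n : ℕ} (l : ℕ → ℝ) :
    ∀ k ≤ n, ∀ x, constCoeff l k x = ((fun k _ => l k : ℕ → ℝ → ℝ) k x : ℂ) := fun _ _ _ => rfl

theorem boundedlyInvertible_const {n : ℕ} (hn : n ≠ 0) {l : ℕ → ℝ} (hl : l n ≠ 0) {z : ℂ}
    (hz : ∀ ξ, polySymbol n (fun k => l k) ξ ≠ z) :
    BoundedlyInvertible (diffOp n fun k _ => l k) z := by
  refine boundedlyInvertible_diffOp (constCoeff_apply l) ?_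
  rw [totalOp_shiftCoeff_constCoeff]
  obtain ⟨g, hg⟩ := exists_normSymbol_mul_eq_one (n := n) (c := shiftConst z l)
    (by simp [shiftConst, hn, hl]) fun ξ => by
      rw [polySymbol_shiftConst, sub_ne_zero]
      exact (hz ξ).symm
  exact (IsUnit.of_mul_eq_one g hg).map fmul

/-- A Fourier multiplier whose symbol has a zero does not bound a Fourier multiplier with a
nonvanishing symbol. -/
theorem not_norm_fmul_le {s r : ℝ →ᵇ ℂ} {ξ₀ : ℝ} (hs : s ξ₀ = 0) (hr : r ξ₀ ≠ 0) (C : ℝ) :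
    ¬ ∀ f : L2, ‖fmul r f‖ ≤ C * ‖fmul s f‖ := by
  intro h
  set ρ := ‖r ξ₀‖ / 2 with hρ
  have hρ0 : 0 < ρ := half_pos (norm_pos_iff.mpr hr)
  -- Chosen so that `(|C| + 1) ε = ρ / 2`. The contradiction comes from a function whose Fourier
  -- transform is the indicator of a ball about `ξ₀` on which `‖s‖ < ε` and `‖r‖ > ρ`.
  set ε := ρ / (2 * (|C| + 1)) with hε
  have hε0 : 0 < ε := by positivity
  have h1 : ∀ᶠ x in 𝓝 ξ₀, ρ < ‖r x‖ ∧ ‖s x‖ < ε := by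
    refine (r.continuous.norm.continuousAt.eventually_const_lt
      (half_lt_self (norm_pos_iff.mpr hr))).and ?_
    refine s.continuous.norm.continuousAt.eventually_lt_const ?_
    simp only [hs, norm_zero]
    exact hε0
  obtain ⟨δ, hδ, hball⟩ := Metric.eventually_nhds_iff_ball.mp h1
  have hfin : volume (Metric.ball ξ₀ δ) ≠ ⊤ := measure_ball_lt_top.ne
  set u : L2 := indicatorConstLp 2 (measurableSet_ball (x := ξ₀) (ε := δ)) hfin (1 : ℂ) with hu
  have hu0 : 0 < ‖u‖ := by
    rw [hu, norm_indicatorConstLp (by norm_num) (by norm_num), norm_one, one_mul]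
    refine Real.rpow_pos_of_pos ?_ _
    exact ENNReal.toReal_pos (Metric.measure_ball_pos _ _ hδ).ne' hfin
  have hF : (𝓕 (𝓕⁻ u : L2) : L2) = u := FourierTransform.fourier_fourierInv_eq u
  have h2 := h (𝓕⁻ u)
  rw [norm_fmul_apply, norm_fmul_apply, hF] at h2
  have h3 : ‖mulOp s u‖ ≤ ε * ‖u‖ := by
    refine Lp.norm_le_mul_norm_of_ae_le_mul ?_
    filter_upwards [mulOp_coeFn s u, indicatorConstLp_coeFn (p := 2)
      (hs := measurableSet_ball (x := ξ₀) (ε := δ)) (hμs := hfin) (c := (1 : ℂ))] with x hx hx'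
    rw [hx, norm_mul]
    by_cases hxb : x ∈ Metric.ball ξ₀ δ
    · gcongr
      exact (hball x hxb).2.le
    · rw [hx', Set.indicator_of_notMem hxb]
      simp
  have h4 : ‖u‖ ≤ ρ⁻¹ * ‖mulOp r u‖ := by
    refine Lp.norm_le_mul_norm_of_ae_le_mul ?_
    filter_upwards [mulOp_coeFn r u, indicatorConstLp_coeFn (p := 2)
      (hs := measurableSet_ball (x := ξ₀) (ε := δ)) (hμs := hfin) (c := (1 : ℂ))] with x hx hx'
    rw [hx, norm_mul]
    by_cases hxb : x ∈ Metric.ball ξ₀ δ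
    · rw [← mul_assoc]
      refine le_mul_of_one_le_left (norm_nonneg _) ?_
      rw [← div_eq_inv_mul, one_le_div hρ0]
      exact (hball x hxb).1.le
    · rw [hx', Set.indicator_of_notMem hxb]
      simp
  have h5 : ρ * ‖u‖ ≤ C * ‖mulOp s u‖ := by
    refine le_trans ?_ h2
    rwa [← inv_mul_le_iff₀ (inv_pos.mpr hρ0), inv_inv] at h4
  have h6 : C * ‖mulOp s u‖ ≤ (|C| + 1) * (ε * ‖u‖) := by
    refine mul_le_mul ?_ h3 (norm_nonneg _) (by positivity)
    linarith [le_abs_self C]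
  have h7 : (|C| + 1) * (ε * ‖u‖) = ρ * ‖u‖ / 2 := by
    rw [hε]
    field_simp
  nlinarith [mul_pos hρ0 hu0]

/-- A bounded inverse would dominate the nonvanishing multiplier `(1 + iξ)⁻ⁿ` by one whose symbol
vanishes at `ξ₀`. -/
theorem not_boundedlyInvertible_const {n : ℕ} {l : ℕ → ℝ} (ξ₀ : ℝ) :
    ¬ BoundedlyInvertible (diffOp n fun k _ => l k) (polySymbol n (fun k => l k) ξ₀) := by
  rintro ⟨R, -, hR⟩
  set z := polySymbol n (fun k => l k) ξ₀ with hz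
  refine not_norm_fmul_le (s := normSymbol n (shiftConst z l)) (r := resSymbol ^ n) (ξ₀ := ξ₀) ?_
    (pow_ne_zero n (resSymbol_ne_zero ξ₀)) ‖R‖ fun f => ?_
  · rw [normSymbol_apply, polySymbol_shiftConst, hz, sub_self, zero_mul]
  · have h := hR (domainEquiv (constCoeff_apply l) f)
    rw [shifted_diffOp_domainEquiv, totalOp_shiftCoeff_constCoeff, coe_domainEquiv] at h
    rw [← h]
    exact R.le_opNorm _

/-- The spectrum of a differential operator with constant coefficients. -/
theorem spec_const {n : ℕ} (hn : n ≠ 0) {l : ℕ → ℝ} (hl : l n ≠ 0) :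
    spec (diffOp n fun k _ => l k) = Set.range (polySymbol n fun k => l k) := by
  ext z
  constructor
  · intro hz
    by_contra hcon
    exact hz (boundedlyInvertible_const hn hl fun ξ h => hcon ⟨ξ, h⟩)
  · rintro ⟨ξ, rfl⟩
    exact not_boundedlyInvertible_const ξ

theorem tendsto_cocompact_zero_of_atBot_atTop {φ : ℝ → ℂ} (hb : Tendsto φ atBot (𝓝 0))
    (ht : Tendsto φ atTop (𝓝 0)) : Tendsto φ (cocompact ℝ) (𝓝 0) := by
  rw [cocompact_eq_atBot_atTop]
  exact hb.sup ht

/-- A differential operator whose coefficients converge at `±∞` has index zero, after a shift, if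
the symbols at `±∞` can be deformed into each other through a third symbol. -/
theorem almostUnit_totalOp {n : ℕ} (hn : n ≠ 0) {A : ℕ → ℝ →ᵇ ℂ} {lb lt : ℕ → ℝ}
    (hb : ∀ k ≤ n, Tendsto (A k) atBot (𝓝 (lb k : ℂ)))
    (ht : ∀ k ≤ n, Tendsto (A k) atTop (𝓝 (lt k : ℂ)))
    {an : ℝ} (han : an ≠ 0) (hAn : ∀ x, A n x = an) {z : ℂ} {c : ℕ → ℂ} (hc : c n = -an)
    (h1 : ∀ ξ, polySymbol n c ξ / (z - polySymbol n (fun k => lb k) ξ) ∈ Complex.slitPlane)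
    (h2 : ∀ ξ, (z - polySymbol n (fun k => lt k) ξ) / polySymbol n c ξ ∈ Complex.slitPlane) :
    AlmostUnit (totalOp n (shiftCoeff z A)) := by
  have hlb : lb n = an := by
    have := hb n le_rfl
    rw [show (A n : ℝ → ℂ) = fun _ => (an : ℂ) from funext hAn] at this
    exact_mod_cast tendsto_nhds_unique this tendsto_const_nhds
  have hlt : lt n = an := by
    have := ht n le_rfl
    rw [show (A n : ℝ → ℂ) = fun _ => (an : ℂ) from funext hAn] at this
    exact_mod_cast tendsto_nhds_unique this tendsto_const_nhds
  set cb := shiftConst z lb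
  set ct := shiftConst z lt
  have hcb : cb n = -an := by simp [cb, shiftConst, hn, hlb]
  have hct : ct n = -an := by simp [ct, shiftConst, hn, hlt]
  have hanC : (-an : ℂ) ≠ 0 := neg_ne_zero.mpr (Complex.ofReal_ne_zero.mpr han)
  simp only [← polySymbol_shiftConst] at h1 h2
  have hb0 : ∀ ξ, polySymbol n cb ξ ≠ 0 := fun ξ h0 => by
    have := h1 ξ
    rw [h0, div_zero] at this
    exact Complex.zero_notMem_slitPlane this
  have hc0 : ∀ ξ, polySymbol n c ξ ≠ 0 := fun ξ h0 => by
    have := h2 ξ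
    rw [h0, div_zero] at this
    exact Complex.zero_notMem_slitPlane this
  obtain ⟨gb, hgb⟩ := exists_normSymbol_mul_eq_one (hcb.trans_ne hanC) hb0
  obtain ⟨gc, hgc⟩ := exists_normSymbol_mul_eq_one (hc.trans_ne hanC) hc0
  -- The quotient of the symbols at `+∞` and `-∞` is split as `m₂ m₁` through `c`. Each factor has
  -- values in the slit plane, which the product need not have.
  set m₁ := normSymbol n c * gb
  set m₂ := normSymbol n ct * gc
  have hm₁ : m₁ ∈ cutoffCommutant := cutoffCommutant.mul_mem (normSymbol_mem_cutoffCommutant n c)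
    (mem_cutoffCommutant_of_mul_eq_one hgb (normSymbol_mem_cutoffCommutant n cb))
  have hm₂ : m₂ ∈ cutoffCommutant := cutoffCommutant.mul_mem (normSymbol_mem_cutoffCommutant n ct)
    (mem_cutoffCommutant_of_mul_eq_one hgc (normSymbol_mem_cutoffCommutant n c))
  have ht₁ : Tendsto (m₁ - 1 : ℝ →ᵇ ℂ) (cocompact ℝ) (𝓝 0) :=
    tendsto_normSymbol_mul_sub_one (hcb.trans_ne hanC) (hc.trans hcb.symm) hgb
  have ht₂ : Tendsto (m₂ - 1 : ℝ →ᵇ ℂ) (cocompact ℝ) (𝓝 0) :=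
    tendsto_normSymbol_mul_sub_one (hc.trans_ne hanC) (hct.trans hc.symm) hgc
  have hu₁ : AlmostUnit (gluing m₁) := almostUnit_gluing hm₁ ht₁ fun ξ => by
    rw [mul_apply_of_normSymbol_mul_eq_one hgb]
    exact h1 ξ
  have hu₂ : AlmostUnit (gluing m₂) := almostUnit_gluing hm₂ ht₂ fun ξ => by
    rw [mul_apply_of_normSymbol_mul_eq_one hgc]
    exact h2 ξ
  have hu : AlmostUnit (gluing (m₁ * m₂) * fmul (normSymbol n cb)) :=
    ((hu₁.mul hu₂).congr (gluing_mul_sub_mem hm₁ ht₁)).mul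
      (AlmostUnit.of_isUnit ((IsUnit.of_mul_eq_one gb hgb).map fmul))
  refine hu.congr ?_
  have hmm : (m₁ * m₂ - 1) * normSymbol n cb = normSymbol n ct - normSymbol n cb := by
    linear_combination (normSymbol n c * normSymbol n ct * gc) * hgb + normSymbol n ct * hgc
  -- Multiplying back by the symbol at `-∞` clears the denominators and leaves a differential
  -- expression with coefficients `cb k + χ (ct k - cb k)`.
  have hglue : gluing (m₁ * m₂) * fmul (normSymbol n cb) =
      ∑ k ∈ Finset.range (n + 1), mulOp (algebraMap ℂ (ℝ →ᵇ ℂ) (cb k) +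
        cutoff * (algebraMap ℂ (ℝ →ᵇ ℂ) (ct k) - algebraMap ℂ (ℝ →ᵇ ℂ) (cb k))) *
          fmul (derivSymbol n k) := by
    rw [gluing, add_mul, one_mul, mul_assoc, ← map_mul, hmm, map_sub, ← totalOp_const,
      ← totalOp_const, totalOp, totalOp, ← Finset.sum_sub_distrib, Finset.mul_sum,
      ← Finset.sum_add_distrib]
    refine Finset.sum_congr rfl fun k _ => ?_
    simp only [map_add, map_sub, map_mul]
    noncomm_ring
  rw [hglue, totalOp, ← Finset.sum_sub_distrib]
  refine Submodule.sum_mem _ fun k hk => ?_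
  rw [← sub_mul, ← map_sub]
  have hk' := Finset.mem_range_succ_iff.mp hk
  set φ : ℝ →ᵇ ℂ := shiftCoeff z A k - (algebraMap ℂ (ℝ →ᵇ ℂ) (cb k) +
    cutoff * (algebraMap ℂ (ℝ →ᵇ ℂ) (ct k) - algebraMap ℂ (ℝ →ᵇ ℂ) (cb k))) with hφ
  have hφx : ∀ x, φ x = (lb k - A k x) + cutoff x * (lt k - lb k) := fun x => by
    have e1 : φ x = shiftCoeff z A k x - (cb k + cutoff x * (ct k - cb k)) := rfl
    have e2 : shiftCoeff z A k x = (if k = 0 then z else 0) - A k x := by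
      rw [shiftCoeff]
      split_ifs <;> rfl
    rw [e1, e2]
    simp only [cb, ct, shiftConst]
    ring
  -- The symbol of order `k = n` does not decay, but there the coefficient error vanishes
  -- identically. For `k < n` both the error and the symbol tend to zero.
  rcases hk'.eq_or_lt with rfl | hlt'
  · have : φ = 0 := by
      ext x
      rw [hφx, hAn, hlb, hlt]
      simp
    rw [this, map_zero, zero_mul]
    exact Submodule.zero_mem _
  · refine mulOp_mul_fmul_mem _ _ (tendsto_cocompact_zero_of_atBot_atTop ?_ ?_)
      (tendsto_derivSymbol_of_lt hlt')
    · have h := (hb k hk').const_sub (lb k : ℂ)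
      rw [sub_self] at h
      refine h.congr' ?_
      filter_upwards [eventually_le_atBot (0 : ℝ)] with x hx
      rw [hφx, cutoff_of_nonpos hx, zero_mul, add_zero]
    · have h := (ht k hk').const_sub (lt k : ℂ)
      rw [sub_self] at h
      refine h.congr' ?_
      filter_upwards [eventually_ge_atTop (1 : ℝ)] with x hx
      rw [hφx, cutoff_of_one_le hx]
      ring

end Asymptotics

/-! ### Essential spectrum of triangular operators -/

section Triangular

variable {E : Type*} [NormedAddCommGroup E] [NormedSpace ℂ E]

theorem indexZero_shifted_triangular {T₁ T₂ : E →ₗ.[ℂ] E} {z : ℂ} (h₁ : IndexZero (shifted T₁ z))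
    (h₂ : IndexZero (shifted T₂ z)) (β : ℂ) : IndexZero (shifted (triangular T₁ β T₂) z) := by
  let e : (triangular T₁ β T₂).domain ≃ₗ[ℂ] T₁.domain × T₂.domain :=
    { toFun := fun u => (⟨u.1.1, u.2.1⟩, ⟨u.1.2, u.2.2⟩)
      map_add' := fun _ _ => rfl
      map_smul' := fun _ _ => rfl
      invFun := fun v => ⟨(v.1, v.2), ⟨v.1.2, v.2.2⟩⟩
      left_inv := fun _ => rfl
      right_inv := fun _ => rfl }
  have h := (h₁.triangular h₂ (-β • T₂.domain.subtype)).comp_equiv e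
  have hs : shifted (triangular T₁ β T₂) z =
      (((shifted T₁ z).coprod (-β • T₂.domain.subtype)).prod
        (shifted T₂ z ∘ₗ LinearMap.snd ℂ T₁.domain T₂.domain)) ∘ₗ e.toLinearMap := by
    refine LinearMap.ext fun u => Prod.ext ?_ rfl
    change z • u.1.1 - (T₁ ⟨u.1.1, u.2.1⟩ + β • u.1.2) =
      (z • u.1.1 - T₁ ⟨u.1.1, u.2.1⟩) + -β • u.1.2
    rw [neg_smul]
    abel
  rw [hs]
  exact h

theorem notMem_essSpec {T : E →ₗ.[ℂ] E} {z : ℂ} (h : IndexZero (shifted T z)) : z ∉ essSpec T := by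
  rintro ⟨-, hz⟩
  obtain ⟨h1, h2, h3⟩ := h.finrank_ker_eq
  exact hz ⟨⟨h1, h2⟩, by rw [fredholmIndex, h3, sub_self]⟩

end Triangular

/-! ### Coefficients of conjugated operators -/

section Conjugation

open scoped BoundedContinuousFunction

theorem exists_bound_of_tendsto {f : ℝ → ℝ} (hf : Continuous f) {lb lt : ℝ}
    (hb : Tendsto f atBot (𝓝 lb)) (ht : Tendsto f atTop (𝓝 lt)) : ∃ C, ∀ x, |f x| ≤ C := by
  obtain ⟨X, hX⟩ := eventually_atTop.mp (ht.abs.eventually_lt_const (lt_add_one |lt|))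
  obtain ⟨Y, hY⟩ := eventually_atBot.mp (hb.abs.eventually_lt_const (lt_add_one |lb|))
  obtain ⟨C, hC⟩ := (isCompact_Icc (a := Y) (b := X)).exists_bound_of_continuousOn hf.continuousOn
  refine ⟨max C (max (|lt| + 1) (|lb| + 1)), fun x => ?_⟩
  by_cases h1 : X ≤ x
  · exact (hX x h1).le.trans ((le_max_left _ _).trans (le_max_right _ _))
  by_cases h2 : x ≤ Y
  · exact (hY x h2).le.trans ((le_max_right _ _).trans (le_max_right _ _))
  · exact (hC x ⟨(not_le.mp h2).le, (not_le.mp h1).le⟩).trans (le_max_left _ _)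

theorem exists_bcf_coeff {n : ℕ} {a : ℕ → ℝ → ℝ} {lb lt : ℕ → ℝ} (ha : ∀ k ≤ n, Continuous (a k))
    (hb : ∀ k ≤ n, Tendsto (a k) atBot (𝓝 (lb k))) (ht : ∀ k ≤ n, Tendsto (a k) atTop (𝓝 (lt k))) :
    ∃ A : ℕ → ℝ →ᵇ ℂ, ∀ k ≤ n, ∀ x, A k x = a k x := by
  have h : ∀ k, ∃ φ : ℝ →ᵇ ℂ, k ≤ n → ∀ x, φ x = a k x := by
    intro k
    by_cases hk : k ≤ n
    · obtain ⟨C, hC⟩ := exists_bound_of_tendsto (ha k hk) (hb k hk) (ht k hk)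
      exact ⟨BoundedContinuousFunction.ofNormedAddCommGroup (fun x => (a k x : ℂ))
        (Complex.continuous_ofReal.comp (ha k hk)) C fun x => by
          rw [Complex.norm_real]
          exact hC x, fun _ _ => rfl⟩
    · exact ⟨0, fun h => absurd h hk⟩
  choose A hA using h
  exact ⟨A, hA⟩

/-- Index zero for a differential operator with asymptotically constant coefficients. -/
theorem indexZero_of_tendsto {n : ℕ} (hn : n ≠ 0) {a : ℕ → ℝ → ℝ} {lb lt : ℕ → ℝ}
    (ha : ∀ k ≤ n, Continuous (a k)) (hb : ∀ k ≤ n, Tendsto (a k) atBot (𝓝 (lb k)))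
    (ht : ∀ k ≤ n, Tendsto (a k) atTop (𝓝 (lt k))) {an : ℝ} (han : an ≠ 0) (hAn : ∀ x, a n x = an)
    {z : ℂ} {c : ℕ → ℂ} (hc : c n = -an)
    (h1 : ∀ ξ, polySymbol n c ξ / (z - polySymbol n (fun k => lb k) ξ) ∈ Complex.slitPlane)
    (h2 : ∀ ξ, (z - polySymbol n (fun k => lt k) ξ) / polySymbol n c ξ ∈ Complex.slitPlane) :
    IndexZero (shifted (diffOp n a) z) := by
  obtain ⟨A, hA⟩ := exists_bcf_coeff ha hb ht
  refine indexZero_shifted_diffOp hA (almostUnit_totalOp hn (fun k hk => ?_) (fun k hk => ?_) han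
    (fun x => by rw [hA n le_rfl, hAn]) hc h1 h2)
  · rw [show (A k : ℝ → ℂ) = fun x => (a k x : ℂ) from funext (hA k hk)]
    exact (Complex.continuous_ofReal.tendsto _).comp (hb k hk)
  · rw [show (A k : ℝ → ℂ) = fun x => (a k x : ℂ) from funext (hA k hk)]
    exact (Complex.continuous_ofReal.tendsto _).comp (ht k hk)

/-- The limits of the coefficients of `w⁻¹ (∑_{j ≤ n} a_j ∂ₓʲ) w` if `a_j` tends to `b_j` and `w`
is `exp (ρ x)` near infinity. -/
def conjLimit (n : ℕ) (ρ : ℝ) (b : ℕ → ℝ) (k : ℕ) : ℝ :=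
  ∑ j ∈ Finset.Icc k n, (j.choose k : ℝ) * b j * ρ ^ (j - k)

/-- Conjugation by `exp (ρ x)` shifts `∂ₓ` to `∂ₓ + ρ`; on symbols this is the binomial theorem. -/
theorem polySymbol_conjLimit (n : ℕ) (ρ : ℝ) (b : ℕ → ℝ) (ξ : ℝ) :
    polySymbol n (fun k => conjLimit n ρ b k) ξ =
      ∑ j ∈ Finset.range (n + 1), (b j : ℂ) * (freq ξ + ρ) ^ j := by
  have h : ∀ j, (freq ξ + (ρ : ℂ)) ^ j = ∑ k ∈ Finset.range (j + 1),
      freq ξ ^ k * (ρ : ℂ) ^ (j - k) * (j.choose k : ℂ) := fun j => add_pow _ _ _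
  simp only [polySymbol, conjLimit, h, Complex.ofReal_sum, Finset.sum_mul, Finset.mul_sum]
  rw [Finset.sum_sigma', Finset.sum_sigma']
  refine Finset.sum_bij' (fun p _ => ⟨p.2, p.1⟩) (fun p _ => ⟨p.2, p.1⟩) ?_ ?_ ?_ ?_ ?_
  · intro p hp
    simp only [Finset.mem_sigma, Finset.mem_range, Finset.mem_Icc] at hp ⊢
    omega
  · intro p hp
    simp only [Finset.mem_sigma, Finset.mem_range, Finset.mem_Icc] at hp ⊢
    omega
  · intro p hp; rfl
  · intro p hp; rfl
  · intro p hp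
    push_cast
    ring

/-- Where `w` is locally `exp (ρ x)`, the ratio of its `i`-th derivative to `w` is exactly `ρⁱ`. -/
theorem tendsto_conjCoeff {l : Filter ℝ} {n : ℕ} {w : ℝ → ℝ} {a : ℕ → ℝ → ℝ} {b : ℕ → ℝ} {ρ : ℝ}
    (ha : ∀ j ≤ n, Tendsto (a j) l (𝓝 (b j)))
    (hw : ∀ᶠ x in l, w =ᶠ[𝓝 x] fun y => Real.exp (ρ * y)) (k : ℕ) :
    Tendsto (conjCoeff n w a k) l (𝓝 (conjLimit n ρ b k)) := by
  refine tendsto_finsetSum _ fun j hj => ?_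
  refine ((ha j (Finset.mem_Icc.mp hj).2).const_mul _).mul ?_
  refine tendsto_const_nhds.congr' ?_
  filter_upwards [hw] with x hx
  rw [hx.iteratedDeriv_eq, hx.eq_of_nhds, iteratedDeriv_exp_const_mul,
    mul_div_cancel_right₀ _ (Real.exp_ne_zero _)]

theorem continuous_conjCoeff {n : ℕ} {w : ℝ → ℝ} {a : ℕ → ℝ → ℝ} (ha : ∀ j ≤ n, Continuous (a j))
    (hw : ContDiff ℝ ∞ w) (hw0 : ∀ x, w x ≠ 0) (k : ℕ) : Continuous (conjCoeff n w a k) := by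
  refine continuous_finsetSum _ fun j hj => ?_
  refine (continuous_const.mul (ha j (Finset.mem_Icc.mp hj).2)).mul ?_
  generalize j - k = i
  exact (hw.continuous_iteratedDeriv i (by exact_mod_cast le_top)).div hw.continuous hw0

theorem conjCoeff_self {n : ℕ} {w : ℝ → ℝ} (a : ℕ → ℝ → ℝ) {x : ℝ} (hw0 : w x ≠ 0) :
    conjCoeff n w a n x = a n x := by
  simp [conjCoeff, hw0]

end Conjugation

/-! ### The linearization at the critical front -/

section Front

theorem freq_eq (ξ : ℝ) : freq ξ = ((2 * Real.pi * ξ : ℝ) : ℂ) * Complex.I := by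
  rw [freq]
  push_cast
  ring

/-- The limits of the coefficients of `A^kpp` where `q` tends to `p`. -/
def kppLimit (d α p : ℝ) : ℕ → ℝ
  | 0 => α * (1 - 3 * p ^ 2)
  | 1 => critSpeed d α
  | 2 => d
  | _ => 0

/-- The limits of the coefficients of `A^sh` where `q` tends to `p`. -/
def shLimit (d α μ γ p : ℝ) : ℕ → ℝ
  | 0 => -1 + μ - γ * (1 - p)
  | 1 => critSpeed d α
  | 2 => -2
  | 4 => -1
  | _ => 0

theorem tendsto_kppCoeff {d α p : ℝ} {q : ℝ → ℝ} {l : Filter ℝ} (hq : Tendsto q l (𝓝 p)) {k : ℕ}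
    (hk : k ≤ 2) : Tendsto (kppCoeff d α q k) l (𝓝 (kppLimit d α p k)) := by
  interval_cases k
  · exact ((((hq.pow 2).const_mul 3).const_sub 1).const_mul α)
  · exact tendsto_const_nhds
  · exact tendsto_const_nhds

theorem tendsto_shCoeff {d α μ γ p : ℝ} {q : ℝ → ℝ} {l : Filter ℝ} (hq : Tendsto q l (𝓝 p))
    {k : ℕ} (hk : k ≤ 4) : Tendsto (shCoeff d α μ γ q k) l (𝓝 (shLimit d α μ γ p k)) := by
  interval_cases k
  · exact ((hq.const_sub 1).const_mul γ).const_sub (-1 + μ)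
  all_goals exact tendsto_const_nhds

theorem continuous_kppCoeff {d α : ℝ} {q : ℝ → ℝ} (hq : Continuous q) {k : ℕ} (hk : k ≤ 2) :
    Continuous (kppCoeff d α q k) := by
  interval_cases k <;> unfold kppCoeff <;> fun_prop

theorem continuous_shCoeff {d α μ γ : ℝ} {q : ℝ → ℝ} (hq : Continuous q) {k : ℕ} (hk : k ≤ 4) :
    Continuous (shCoeff d α μ γ q k) := by
  interval_cases k <;> unfold shCoeff <;> fun_prop

/-! ### Symbols of the asymptotic operators. -/

theorem polySymbol_kpp (d α p ρ ξ : ℝ) :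
    polySymbol 2 (fun k => conjLimit 2 ρ (kppLimit d α p) k) ξ =
      ((α * (1 - 3 * p ^ 2) + critSpeed d α * ρ + d * ρ ^ 2 - d * (2 * Real.pi * ξ) ^ 2 : ℝ) : ℂ) +
        (((critSpeed d α + 2 * d * ρ) * (2 * Real.pi * ξ) : ℝ) : ℂ) * Complex.I := by
  rw [polySymbol_conjLimit, freq_eq]
  simp only [Finset.sum_range_succ, Finset.range_zero, Finset.sum_empty, kppLimit]
  push_cast
  linear_combination (d : ℂ) * (2 * Real.pi * ξ) ^ 2 * Complex.I_sq

theorem re_polySymbol_kpp (d α p ρ ξ : ℝ) :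
    (polySymbol 2 (fun k => conjLimit 2 ρ (kppLimit d α p) k) ξ).re =
      α * (1 - 3 * p ^ 2) + critSpeed d α * ρ + d * ρ ^ 2 - d * (2 * Real.pi * ξ) ^ 2 := by
  rw [polySymbol_kpp, Complex.add_re, Complex.re_ofReal_mul, Complex.I_re, mul_zero, add_zero,
    Complex.ofReal_re]

/-- With `t = 2πξ`, the two sides differ exactly by the square `(3ρ² + 1 - t²)²`. -/
theorem re_polySymbol_sh_le (d α μ γ p ρ ξ : ℝ) :
    (polySymbol 4 (fun k => conjLimit 4 ρ (shLimit d α μ γ p) k) ξ).re ≤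
      8 * ρ ^ 4 + 4 * ρ ^ 2 + critSpeed d α * ρ + μ - γ * (1 - p) := by
  set t := 2 * Real.pi * ξ with ht
  have h : polySymbol 4 (fun k => conjLimit 4 ρ (shLimit d α μ γ p) k) ξ =
      ((-1 + μ - γ * (1 - p) + critSpeed d α * ρ - 2 * (ρ ^ 2 - t ^ 2) -
        (ρ ^ 4 - 6 * ρ ^ 2 * t ^ 2 + t ^ 4) : ℝ) : ℂ) +
      ((critSpeed d α * t - 4 * ρ * t - 4 * ρ ^ 3 * t + 4 * ρ * t ^ 3 : ℝ) : ℂ) * Complex.I := by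
    rw [polySymbol_conjLimit, freq_eq]
    simp only [Finset.sum_range_succ, Finset.range_zero, Finset.sum_empty, shLimit, ← ht]
    push_cast
    linear_combination (-2 * (t : ℂ) ^ 2 - 6 * ρ ^ 2 * t ^ 2 - 4 * ρ * t ^ 3 * Complex.I -
      t ^ 4 * (Complex.I ^ 2 - 1)) * Complex.I_sq
  rw [h, Complex.add_re, Complex.re_ofReal_mul, Complex.I_re, mul_zero, add_zero,
    Complex.ofReal_re]
  nlinarith [sq_nonneg (3 * ρ ^ 2 + 1 - t ^ 2)]

/-- If `z = -r w` with `r ≥ 0`, the real parts of `z` and `w` cannot both be positive. -/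
theorem div_mem_slitPlane_of_re_pos {z w : ℂ} (hz : 0 < z.re) (hw : 0 < w.re) :
    z / w ∈ Complex.slitPlane := by
  have hw0 : w ≠ 0 := fun h => by simp [h] at hw
  rw [Complex.mem_slitPlane_iff]
  by_contra hcon
  push Not at hcon
  have h : z = (z / w) * w := (div_mul_cancel₀ z hw0).symm
  have hre := congrArg Complex.re h
  rw [Complex.mul_re, hcon.2, zero_mul, sub_zero] at hre
  nlinarith [hcon.1]

theorem mem_slitPlane_of_notMem_negSquares {z : ℂ} (hz : z ∉ negSquares) :
    z ∈ Complex.slitPlane := by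
  rw [Complex.mem_slitPlane_iff]
  by_contra hcon
  push Not at hcon
  refine hz ⟨√(-z.re), ?_⟩
  rw [← Complex.ofReal_pow, Real.sq_sqrt (by linarith [hcon.1])]
  refine Complex.ext ?_ ?_ <;> simp [hcon.2]

/-! ### The weighted operators at a critical front. -/

variable {d α μ γ θ : ℝ} {q w₁ w₂ : ℝ → ℝ}

theorem critSpeed_pos (hd : 0 < d) (hα : 0 < α) : 0 < critSpeed d α := by
  unfold critSpeed
  positivity

theorem critSpeed_sq (hd : 0 < d) (hα : 0 < α) : critSpeed d α ^ 2 = 4 * (d * α) := by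
  rw [critSpeed, mul_pow, Real.sq_sqrt (by positivity)]
  ring

theorem weight_atBot (h₁ : IsKppWeight d α w₁) (h₂ : IsShWeight θ w₂) :
    ∀ᶠ x in atBot, (w₁ * w₂) =ᶠ[𝓝 x] fun y => Real.exp (θ * y) := by
  filter_upwards [eventually_lt_atBot (-1 : ℝ)] with x hx
  filter_upwards [eventually_lt_nhds hx] with y hy
  rw [Pi.mul_apply, h₁.eq_left y hy.le, h₂.eq_left y hy.le, one_mul]

theorem weight_atTop (h₁ : IsKppWeight d α w₁) (h₂ : IsShWeight θ w₂) :
    ∀ᶠ x in atTop, (w₁ * w₂) =ᶠ[𝓝 x] fun y => Real.exp (-(critSpeed d α / (2 * d)) * y) := by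
  filter_upwards [eventually_gt_atTop (1 : ℝ)] with x hx
  filter_upwards [eventually_gt_nhds hx] with y hy
  rw [Pi.mul_apply, h₁.eq_right y hy.le, h₂.eq_right y hy.le, mul_one]

theorem weight_ne_zero (h₁ : IsKppWeight d α w₁) (h₂ : IsShWeight θ w₂) (x : ℝ) :
    (w₁ * w₂) x ≠ 0 := (mul_pos (h₁.pos x) (h₂.pos x)).ne'

theorem tendsto_kppConj_atBot (hq : IsCriticalFront d α q) (h₁ : IsKppWeight d α w₁)
    (h₂ : IsShWeight θ w₂) (k : ℕ) :
    Tendsto (kppConj d α q (w₁ * w₂) k) atBot (𝓝 (conjLimit 2 θ (kppLimit d α 1) k)) :=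
  tendsto_conjCoeff (fun _ hj => tendsto_kppCoeff hq.tendsto_atBot hj) (weight_atBot h₁ h₂) k

theorem tendsto_kppConj_atTop (hq : IsCriticalFront d α q) (h₁ : IsKppWeight d α w₁)
    (h₂ : IsShWeight θ w₂) (k : ℕ) :
    Tendsto (kppConj d α q (w₁ * w₂) k) atTop
      (𝓝 (conjLimit 2 (-(critSpeed d α / (2 * d))) (kppLimit d α 0) k)) :=
  tendsto_conjCoeff (fun _ hj => tendsto_kppCoeff hq.tendsto_atTop hj) (weight_atTop h₁ h₂) k

theorem tendsto_shConj_atBot (hq : IsCriticalFront d α q) (h₁ : IsKppWeight d α w₁)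
    (h₂ : IsShWeight θ w₂) (k : ℕ) :
    Tendsto (shConj d α μ γ q (w₁ * w₂) k) atBot (𝓝 (conjLimit 4 θ (shLimit d α μ γ 1) k)) :=
  tendsto_conjCoeff (fun _ hj => tendsto_shCoeff hq.tendsto_atBot hj) (weight_atBot h₁ h₂) k

theorem tendsto_shConj_atTop (hq : IsCriticalFront d α q) (h₁ : IsKppWeight d α w₁)
    (h₂ : IsShWeight θ w₂) (k : ℕ) :
    Tendsto (shConj d α μ γ q (w₁ * w₂) k) atTop
      (𝓝 (conjLimit 4 (-(critSpeed d α / (2 * d))) (shLimit d α μ γ 0) k)) :=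
  tendsto_conjCoeff (fun _ hj => tendsto_shCoeff hq.tendsto_atTop hj) (weight_atTop h₁ h₂) k

/-- The spectrum of an asymptotic operator is the range of its symbol. -/
theorem spec_asymptotic {l : Filter ℝ} [l.NeBot] {n : ℕ} (hn : n ≠ 0) {a : ℕ → ℝ → ℝ} {b : ℕ → ℝ}
    (h : ∀ k, Tendsto (a k) l (𝓝 (b k))) (hb : b n ≠ 0) :
    spec (diffOp n (asymptotic l a)) = Set.range (polySymbol n fun k => b k) := by
  have e : asymptotic l a = fun k _ => b k := funext fun k => funext fun _ => (h k).limUnder_eq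
  rw [e, spec_const hn hb]

theorem conjLimit_self (n : ℕ) (ρ : ℝ) (b : ℕ → ℝ) : conjLimit n ρ b n = b n := by
  simp [conjLimit]

/-- At the critical speed, `ρ = -c_*/(2d)` is a double root of `dρ² + c_* ρ + α`. Thus the constant
and first-order terms of the conjugated operator both vanish. -/
theorem polySymbol_kpp_atTop (hd : 0 < d) (hα : 0 < α) (ξ : ℝ) :
    polySymbol 2 (fun k => conjLimit 2 (-(critSpeed d α / (2 * d))) (kppLimit d α 0) k) ξ =
      -(((d * (2 * Real.pi * ξ) ^ 2 : ℝ)) : ℂ) := by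
  have hc := critSpeed_sq hd hα
  have h1 : α * (1 - 3 * (0 : ℝ) ^ 2) + critSpeed d α * -(critSpeed d α / (2 * d)) +
      d * (-(critSpeed d α / (2 * d))) ^ 2 - d * (2 * Real.pi * ξ) ^ 2 =
      -(d * (2 * Real.pi * ξ) ^ 2) := by
    field_simp
    rw [hc]
    ring
  have h2 : critSpeed d α + 2 * d * -(critSpeed d α / (2 * d)) = 0 := by
    field_simp
    ring
  rw [polySymbol_kpp, h1, h2]
  push_cast
  ring

theorem spec_kpp_atTop (hd : 0 < d) (hα : 0 < α) (hq : IsCriticalFront d α q)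
    (h₁ : IsKppWeight d α w₁) (h₂ : IsShWeight θ w₂) :
    spec (diffOp 2 (asymptotic Filter.atTop (kppConj d α q (w₁ * w₂)))) = negSquares := by
  rw [spec_asymptotic two_ne_zero (tendsto_kppConj_atTop hq h₁ h₂)
    (by rw [conjLimit_self]; exact hd.ne')]
  ext z
  constructor
  · rintro ⟨ξ, rfl⟩
    refine ⟨√d * (2 * Real.pi * ξ), ?_⟩
    rw [polySymbol_kpp_atTop hd hα, ← Complex.ofReal_pow, mul_pow √d, Real.sq_sqrt hd.le]
  · rintro ⟨x, rfl⟩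
    refine ⟨x / √d / (2 * Real.pi), ?_⟩
    rw [polySymbol_kpp_atTop hd hα, mul_div_cancel₀ _ (by positivity), div_pow, Real.sq_sqrt hd.le,
      mul_div_cancel₀ _ hd.ne', Complex.ofReal_pow]

/-- The shifted symbol at `+∞` may have negative real part, so its quotient by the one at `-∞` can
meet the slit. The detour is `1 + s` with `s = d (2πξ)² ≥ 0`. Its quotient by the symbol at `-∞`
involves two points of the right half plane, and `(z + s)/(1 + s)` avoids the slit because `z` does.
-/
theorem indexZero_kpp (hd : 0 < d) (hα : 0 < α) (hq : IsCriticalFront d α q)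
    (h₁ : IsKppWeight d α w₁) (h₂ : IsShWeight θ w₂) {z : ℂ} (hz : z ∉ negSquares)
    (hre : ∀ ξ, (polySymbol 2 (fun k => conjLimit 2 θ (kppLimit d α 1) k) ξ).re < z.re) :
    IndexZero (shifted (diffOp 2 (kppConj d α q (w₁ * w₂))) z) := by
  let c : ℕ → ℂ := fun k => if k = 0 then 1 else if k = 2 then -d else 0
  have hpos : ∀ ξ : ℝ, 0 ≤ d * (2 * Real.pi * ξ) ^ 2 := fun ξ => by positivity
  have hcs : ∀ ξ, polySymbol 2 c ξ = ((1 + d * (2 * Real.pi * ξ) ^ 2 : ℝ) : ℂ) := fun ξ => by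
    simp only [polySymbol, Finset.sum_range_succ, Finset.range_zero, Finset.sum_empty, c, freq_eq]
    push_cast
    simp
    linear_combination -(d : ℂ) * (2 * Real.pi * ξ) ^ 2 * Complex.I_sq
  have hw0 := weight_ne_zero h₁ h₂
  refine indexZero_of_tendsto two_ne_zero (c := c) (an := d)
    (fun k _ => continuous_conjCoeff (fun j hj => continuous_kppCoeff hq.contDiff.continuous hj)
      (h₁.contDiff.mul h₂.contDiff) hw0 k)
    (fun k _ => tendsto_kppConj_atBot hq h₁ h₂ k) (fun k _ => tendsto_kppConj_atTop hq h₁ h₂ k)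
    hd.ne' (fun x => conjCoeff_self _ (hw0 x)) (by simp [c]) (fun ξ => ?_) fun ξ => ?_
  · refine div_mem_slitPlane_of_re_pos ?_ ?_
    · rw [hcs, Complex.ofReal_re]
      linarith [hpos ξ]
    · rw [Complex.sub_re]
      linarith [hre ξ]
  · rw [hcs, polySymbol_kpp_atTop hd hα, sub_neg_eq_add]
    have hz' := Complex.mem_slitPlane_iff.mp (mem_slitPlane_of_notMem_negSquares hz)
    have h1 : 0 < 1 + d * (2 * Real.pi * ξ) ^ 2 := by linarith [hpos ξ]
    rw [Complex.mem_slitPlane_iff, Complex.div_ofReal_re, Complex.div_ofReal_im, Complex.add_re,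
      Complex.add_im, Complex.ofReal_re, Complex.ofReal_im, add_zero]
    rcases hz' with h | h
    · exact Or.inl (div_pos (by linarith [hpos ξ]) h1)
    · exact Or.inr (div_ne_zero h h1.ne')

/-- Here both shifted symbols lie in the right half plane. The intermediate symbol can be the one at
`+∞`, which makes the second quotient `1`. -/
theorem indexZero_sh (hq : IsCriticalFront d α q) (h₁ : IsKppWeight d α w₁)
    (h₂ : IsShWeight θ w₂) {z : ℂ}
    (hb : ∀ ξ, (polySymbol 4 (fun k => conjLimit 4 θ (shLimit d α μ γ 1) k) ξ).re < z.re)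
    (ht : ∀ ξ, (polySymbol 4 (fun k => conjLimit 4 (-(critSpeed d α / (2 * d)))
      (shLimit d α μ γ 0) k) ξ).re < z.re) :
    IndexZero (shifted (diffOp 4 (shConj d α μ γ q (w₁ * w₂))) z) := by
  have hw0 := weight_ne_zero h₁ h₂
  refine indexZero_of_tendsto four_ne_zero (an := -1)
    (c := shiftConst z (conjLimit 4 (-(critSpeed d α / (2 * d))) (shLimit d α μ γ 0)))
    (fun k _ => continuous_conjCoeff (fun j hj => continuous_shCoeff hq.contDiff.continuous hj)
      (h₁.contDiff.mul h₂.contDiff) hw0 k)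
    (fun k _ => tendsto_shConj_atBot hq h₁ h₂ k) (fun k _ => tendsto_shConj_atTop hq h₁ h₂ k)
    (by norm_num) (fun x => conjCoeff_self _ (hw0 x))
    (by simp [shiftConst, conjLimit_self, shLimit]) (fun ξ => ?_) fun ξ => ?_
  · rw [polySymbol_shiftConst]
    refine div_mem_slitPlane_of_re_pos ?_ ?_
    · rw [Complex.sub_re]
      linarith [ht ξ]
    · rw [Complex.sub_re]
      linarith [hb ξ]
  · rw [polySymbol_shiftConst, div_self]
    · exact Complex.one_mem_slitPlane
    · intro h0
      have := congrArg Complex.re h0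
      rw [Complex.sub_re, Complex.zero_re] at this
      linarith [ht ξ]

end Front

end FrontSpectrum

end


/-! ### Choice of the weight exponent and of the spectral gap. -/

theorem mainTheorem6 (d α : ℝ) (hd : 0 < d) (hα : 0 < α) :
    ∃ M : ℝ, 0 < M ∧ ∃ θ : ℝ → ℝ → ℝ,
      -- `θ → 0` as `μ₀ → 0`
      (∀ ε : ℝ, 0 < ε → ∃ δ : ℝ, 0 < δ ∧
        ∀ μ₀ μ : ℝ, 0 < μ → μ < μ₀ → μ₀ < δ → |θ μ₀ μ| < ε) ∧
      ∀ μ₀ : ℝ, 0 < μ₀ → μ₀ < M →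
        (∀ μ : ℝ, 0 < μ → μ < μ₀ → θ μ₀ μ < 0) ∧
        ∀ γ : ℝ, gammaRem d α μ₀ < γ → ∃ η : ℝ, 0 < η ∧
          ∀ (μ β : ℝ) (q w₁ w₂ : ℝ → ℝ), 0 < μ → μ < μ₀ →
            IsCriticalFront d α q → IsKppWeight d α w₁ → IsShWeight (θ μ₀ μ) w₂ →
            -- the asymptotic operators are well defined
            HasAsymptotics 2 (kppConj d α q (w₁ * w₂)) ∧
            HasAsymptotics 4 (shConj d α μ γ q (w₁ * w₂)) ∧
            -- the four Fredholm borders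
            spec (diffOp 2 (asymptotic Filter.atTop (kppConj d α q (w₁ * w₂))))
              = negSquares ∧
            spec (diffOp 2 (asymptotic Filter.atBot (kppConj d α q (w₁ * w₂))))
              ⊆ leftHalfPlane (-3 * η) ∧
            spec (diffOp 4 (asymptotic Filter.atTop (shConj d α μ γ q (w₁ * w₂))))
              ⊆ leftHalfPlane (-3 * η) ∧
            spec (diffOp 4 (asymptotic Filter.atBot (shConj d α μ γ q (w₁ * w₂))))
              ⊆ leftHalfPlane (-3 * η) ∧
            -- the essential spectrum of the weighted operator
            essSpec (weightedOp d α β μ γ q (w₁ * w₂))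
              ⊆ leftHalfPlane (-3 * η) ∪ negSquares ∧
            essSpec (weightedOp d α β μ γ q (w₁ * w₂))
              ⊆ leftHalfPlane (-η) ∪ negSquares := by
  have hc := critSpeed_pos hd hα
  have hc2 := critSpeed_sq hd hα
  set c := critSpeed d α with hcdef
  -- The exponent `-τ` with `τ = 2μ₀/c` makes the transport term equal to `-2μ₀`. The three bounds
  -- on `μ₀` give, in order, `12τ² ≤ μ₀/2`, `τ ≤ 1` and `dτ ≤ c`.
  refine ⟨min (c ^ 2 / 96) (min (c / 2) (c ^ 2 / (2 * d))), by positivity,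
    fun μ₀ _ => -(2 * μ₀ / c), fun ε hε => ⟨ε * c / 2, by positivity, fun μ₀ μ h0 h1 h2 => ?_⟩,
    fun μ₀ hμ₀ hM => ⟨fun μ _ _ => neg_neg_of_pos (by positivity), fun γ hγ => ?_⟩⟩
  · have hμ₀ : 0 < μ₀ := h0.trans h1
    rw [abs_neg, abs_of_pos (by positivity), div_lt_iff₀ hc]
    linarith
  have hM1 : μ₀ < c ^ 2 / 96 := hM.trans_le (min_le_left _ _)
  have hM2 : μ₀ < c / 2 := hM.trans_le ((min_le_right _ _).trans (min_le_left _ _))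
  have hM3 : μ₀ < c ^ 2 / (2 * d) := hM.trans_le ((min_le_right _ _).trans (min_le_right _ _))
  set τ := 2 * μ₀ / c with hτ
  have hτ0 : 0 < τ := by positivity
  have hτc : c * τ = 2 * μ₀ := by rw [hτ]; field_simp
  have hτ1 : τ ≤ 1 := by
    rw [hτ, div_le_one hc]
    linarith
  have hτd : d * τ ≤ c := by
    rw [lt_div_iff₀ (by positivity)] at hM3
    nlinarith
  have hτs : 12 * τ ^ 2 ≤ μ₀ / 2 := by
    have : 12 * τ ^ 2 = 48 * μ₀ ^ 2 / c ^ 2 := by rw [hτ]; field_simp; ring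
    rw [this, div_le_iff₀ (by positivity)]
    nlinarith
  -- the three spectral gaps
  set g := min (2 * α) (min (μ₀ / 2) (γ - gammaRem d α μ₀)) with hg
  have hg0 : 0 < g := lt_min (by positivity) (lt_min (by positivity) (sub_pos.mpr hγ))
  have hg1 : g ≤ 2 * α := min_le_left _ _
  have hg2 : g ≤ μ₀ / 2 := (min_le_right _ _).trans (min_le_left _ _)
  have hg3 : g ≤ γ - gammaRem d α μ₀ := (min_le_right _ _).trans (min_le_right _ _)
  refine ⟨g / 3, by positivity, fun μ β q w₁ w₂ hμ hμμ₀ hq h₁ h₂ => ?_⟩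
  have h3 : -3 * (g / 3) = -g := by ring
  rw [h3]
  have hkb : ∀ ξ, (polySymbol 2 (fun k => conjLimit 2 (-τ) (kppLimit d α 1) k) ξ).re ≤ -g := by
    intro ξ
    rw [re_polySymbol_kpp, ← hcdef]
    have : 0 ≤ d * (2 * Real.pi * ξ) ^ 2 := by positivity
    -- `-cτ + dτ² ≤ 0` because `dτ ≤ c`, so the real part is at most `-2α`.
    nlinarith
  have hsb : ∀ ξ, (polySymbol 4 (fun k => conjLimit 4 (-τ) (shLimit d α μ γ 1) k) ξ).re ≤ -g := by
    intro ξ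
    refine (re_polySymbol_sh_le _ _ _ _ _ _ _).trans ?_
    rw [← hcdef]
    have h4 : τ ^ 4 ≤ τ ^ 2 := pow_le_pow_of_le_one hτ0.le hτ1 (by norm_num)
    have e : (-τ) ^ 4 = τ ^ 4 := by ring
    have e' : (-τ) ^ 2 = τ ^ 2 := by ring
    rw [e, e']
    -- `8τ⁴ + 4τ² ≤ 12τ² ≤ μ₀/2`, and `-2μ₀ + μ < -μ₀`, so the sum lies below `-μ₀/2`, uniformly in
    -- `μ`.
    linarith
  have hst : ∀ ξ, (polySymbol 4 (fun k => conjLimit 4 (-(c / (2 * d))) (shLimit d α μ γ 0) k) ξ).re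
      ≤ -g := by
    intro ξ
    refine (re_polySymbol_sh_le _ _ _ _ _ _ _).trans ?_
    rw [← hcdef]
    have e1 : (-(c / (2 * d))) ^ 2 = α / d := by
      rw [neg_sq, div_pow, hc2]
      field_simp
      ring
    have e2 : (-(c / (2 * d))) ^ 4 = (α / d) ^ 2 := by
      rw [← e1]
      ring
    have e3 : c * -(c / (2 * d)) = -(2 * α) := by
      have : c * -(c / (2 * d)) = -(c ^ 2 / (2 * d)) := by ring
      rw [this, hc2]
      field_simp
      ring
    -- The bound becomes `gammaRem d α μ₀ - μ₀ + μ - γ`; the `μ₀` in the threshold absorbs `μ`.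
    rw [e1, e2, e3]
    unfold gammaRem at hg3
    linarith
  have hess : essSpec (weightedOp d α β μ γ q (w₁ * w₂)) ⊆ leftHalfPlane (-g) ∪ negSquares := by
    intro z hz
    by_contra hcon
    rw [Set.mem_union, not_or] at hcon
    have hzre : -g < z.re := not_le.mp hcon.1
    exact notMem_essSpec (indexZero_shifted_triangular
      (indexZero_kpp hd hα hq h₁ h₂ hcon.2 fun ξ => (hkb ξ).trans_lt hzre)
      (indexZero_sh hq h₁ h₂ (fun ξ => (hsb ξ).trans_lt hzre)
        fun ξ => (hst ξ).trans_lt hzre) β) hz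
  refine ⟨fun k _ => ⟨⟨_, tendsto_kppConj_atTop hq h₁ h₂ k⟩, _, tendsto_kppConj_atBot hq h₁ h₂ k⟩,
    fun k _ => ⟨⟨_, tendsto_shConj_atTop hq h₁ h₂ k⟩, _, tendsto_shConj_atBot hq h₁ h₂ k⟩,
    spec_kpp_atTop hd hα hq h₁ h₂, ?_, ?_, ?_, hess, hess.trans (Set.union_subset_union_left _ ?_)⟩
  · rw [spec_asymptotic two_ne_zero (tendsto_kppConj_atBot hq h₁ h₂)
      (by rw [conjLimit_self]; exact hd.ne')]
    rintro _ ⟨ξ, rfl⟩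
    exact hkb ξ
  · rw [spec_asymptotic four_ne_zero (tendsto_shConj_atTop hq h₁ h₂)
      (by rw [conjLimit_self]; norm_num [shLimit])]
    rintro _ ⟨ξ, rfl⟩
    exact hst ξ
  · rw [spec_asymptotic four_ne_zero (tendsto_shConj_atBot hq h₁ h₂)
      (by rw [conjLimit_self]; norm_num [shLimit])]
    rintro _ ⟨ξ, rfl⟩
    exact hsb ξ
  · intro z (hz : z.re ≤ -g)
    change z.re ≤ -(g / 3)
    linarith
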